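/- **Setting.** Let $n_1,n_2\ge 1$, let $X\subseteq\mathbb{R}^{m_1}$, $Y\subseteq\mathbb{R}^{m_2}$ be closed and convex, and let $f_i$ ($1\le i\le n_1$), $g_j$ ($1\le j\le n_2$) be real functions on $\mathbb{R}^{m_1}\times\mathbb{R}^{m_2}$, convex in the first and concave in the second argument, with $U(x,y):=\sum_i f_i(x,y)=\sum_j g_j(x,y)$ for $x\in X$, $y\in Y$. A saddle point of $\varphi$ on $X\times Y$ is $(x^*,y^*)\in X\times Y$ with $\varphi(x^*,y)\le\varphi(x^*,y^*)\le\varphi(x,y^*)$ for all $x\in X,y\in Y$; the Nash equilibria are the saddle points of $U$ on $X\times Y$. $\partial_x$ (resp. $\partial_y$) denotes the subdifferential of the convex (resp. concave) partial function, $P_K$ the projection onto $K$. The agents form two subnetworks $\mathcal V_1,\mathcal V_2$ with $|\mathcal V_\ell|=n_\ell$. At each time $k=0,1,\dots$ there is a digraph on $\mathcal V_1\cup\mathcal V_2$ containing all self-loops, with weights $a_{ij}(k)\ge0$, positive exactly when $(j,i)$ is an arc. $\mathcal N_i^\ell(k)=\{j\in\mathcal V_\ell:(j,i)\text{ is an arc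 at time }k\}$ and $A_\ell(k)=(a_{ij}(k))_{i,j\in\mathcal V_\ell}$. **Algorithm.** From arbitrary $x_i(0)\in\mathbb{R}^{m_1}$, $y_i(0)\in\mathbb{R}^{m_2}$, with stepsizes $\alpha_{i,k},\beta_{i,k}>0$, $$x_i(k+1)=P_X\big(\hat x_i(k)-\alpha_{i,k}q_{1i}(k)\big),\quad q_{1i}(k)\in\partial_xf_i(\hat x_i(k),\breve x_i(k)),\quad i\in\mathcal V_1,$$ $$y_i(k+1)=P_Y\big(\hat y_i(k)+\beta_{i,k}q_{2i}(k)\big),\quad q_{2i}(k)\in\partial_yg_i(\breve y_i(k),\hat y_i(k)),\quad i\in\mathcal V_2,$$ where $\hat x_i(k)=\sum_{j\in\mathcal N_i^1(k)}a_{ij}(k)x_j(k)$, $\hat y_i(k)=\sum_{j\in\mathcal N_i^2(k)}a_{ij}(k)y_j(k)$, $\breve x_i(k)=\sum_{j\in\mathcal N_i^2(\breve k_i)}a_{ij}(\breve k_i)y_j(\breve k_i)$, $\breve y_i(k)=\sum_{j\in\mathcal N_i^1(\breve k_i)}a_{ij}(\breve k_i)x_j(\breve k_i)$, and, for $i\in\mathcal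 V_\ell$, $\breve k_i=\max\{s\le k:\mathcal N_i^{3-\ell}(s)\ne\emptyset\}$; at the initial times at which no such $s$ exists, $\breve x_i(k)$ (resp. $\breve y_i(k)$) is an arbitrary point. The network *achieves a Nash equilibrium* if for all initial states (and all choices of subgradients) there is a saddle point $(x^*,y^*)$ of $U$ on $X\times Y$ with $x_i(k)\to x^*$ for all $i\in\mathcal V_1$ and $y_i(k)\to y^*$ for all $i\in\mathcal V_2$. **Assumptions.** - A1: for each stochastic vector $\mu$, $\sum_i\mu_if_i$ has a saddle point on $X\times Y$. - A2: there is $T_{\bowtie}>0$ such that for every $k\ge0$ each agent of $\mathcal V_\ell$ ($\ell=1,2$) has at some time in $[k,k+T_{\bowtie})$ a neighbor in $\mathcal V_{3-\ell}$; and for $\ell=1,2$ there is $T_\ell>0$ such that for every $k\ge 0$ the union over the times in $[k,k+T_\ell)$ of the digraphs induced on $\mathcal V_\ell$ is strongly connected. - A3: there is $0<\eta<1$ with $a_{ij}(k)\ge\eta$ for every arc $(j,i)$ at time $k$; $\sum_{j\in\mathcal N_i^\ell(k)}a_{ij}(k)=1$ for all $k$ and $i\in\mathcal V_\ell$; and $\sum_{j\in\mathcal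 N_i^{3-\ell}(k)}a_{ij}(k)=1$ for $i\in\mathcal V_\ell$ whenever $\mathcal N_i^{3-\ell}(k)\neq\emptyset$. - A4: there is $L>0$ with $|q|\le L$ for all $x\in X$, $y\in Y$, all $i,j$ and all $q\in\partial_xf_i(x,y)\cup\partial_yg_j(x,y)$. **Theorem.** Suppose A1, A3, A4 hold and $U$ is strictly convex-concave on $X\times Y$ (for $y\in Y$, $U(\cdot,y)$ is strictly convex on $X$; for $x\in X$, $U(x,\cdot)$ is strictly concave on $Y$). Then for all time-varying communication graphs satisfying A2 (possibly weight-unbalanced) there exist stepsizes $\alpha_{i,k},\beta_{i,k}>0$ with which the network achieves a Nash equilibrium. Explicitly, with $\Phi^\ell(r,s)=A_\ell(r)A_\ell(r-1)\cdots A_\ell(s)$, for $\ell=1,2$ and every $s\ge0$ there is a positive stochastic vector $\phi^\ell(s)$ with $\lim_{r\to\infty}\Phi^\ell(r,s)=\mathbf 1\,\phi^\ell(s)'$ (so $\phi^\ell(s)$ is the Perron vector of this limit), and the network achieves a Nash equilibrium with $$\alpha_{i,k}=\frac{\gamma_k}{\phi^1_i(k+1)},\qquad \beta_{i,k}=\frac{\gamma_k}{\phi^2_i(k+1)}$$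 for every positive non-increasing sequence $\{\gamma_k\}$ with $\lim_{k\to\infty}\gamma_k\sum_{s=0}^{k-1}\gamma_s=0$, $\sum_k\gamma_k=\infty$ and $\sum_k\gamma_k^2<\infty$. -/

import Mathlib

open Filter Topology

/-- The Euclidean space `ℝ^m`. -/
abbrev RVec (m : ℕ) : Type := EuclideanSpace ℝ (Fin m)

/-! ### Convex analysis -/

/-- The subdifferential of a convex function on `ℝ^m` at `z`. -/
def convexSubdiff {m : ℕ} (φ : RVec m → ℝ) (z : RVec m) : Set (RVec m) :=
  {v | ∀ w, φ w ≥ φ z + inner ℝ (w - z) v}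

/-- The subdifferential of a concave function on `ℝ^m` at `z`. -/
def concaveSubdiff {m : ℕ} (φ : RVec m → ℝ) (z : RVec m) : Set (RVec m) :=
  {v | ∀ w, φ w ≤ φ z + inner ℝ (w - z) v}

/-- `p` is the projection `P_K(z)`: the point of `K` at minimal distance from `z`
(unique when `K` is closed and convex). -/
def IsProjection {m : ℕ} (K : Set (RVec m)) (z p : RVec m) : Prop :=
  p ∈ K ∧ ‖z - p‖ = Metric.infDist z K

/-- `φ` is convex in its first and concave in its second argument, on the whole space. -/
def ConvexConcave {m₁ m₂ : ℕ} (φ : RVec m₁ → RVec m₂ → ℝ) : Prop :=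
  (∀ y, ConvexOn ℝ Set.univ fun x => φ x y) ∧ (∀ x, ConcaveOn ℝ Set.univ fun y => φ x y)

/-- `φ` is strictly convex-concave on `X × Y`. -/
def StrictConvexConcaveOn {m₁ m₂ : ℕ} (X : Set (RVec m₁)) (Y : Set (RVec m₂))
    (φ : RVec m₁ → RVec m₂ → ℝ) : Prop :=
  (∀ y ∈ Y, StrictConvexOn ℝ X fun x => φ x y) ∧ (∀ x ∈ X, StrictConcaveOn ℝ Y fun y => φ x y)

/-- `(xs, ys)` is a saddle point of `φ` on `X × Y`. -/
def IsSaddlePoint {m₁ m₂ : ℕ} (X : Set (RVec m₁)) (Y : Set (RVec m₂))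
    (φ : RVec m₁ → RVec m₂ → ℝ) (xs : RVec m₁) (ys : RVec m₂) : Prop :=
  xs ∈ X ∧ ys ∈ Y ∧ ∀ x ∈ X, ∀ y ∈ Y, φ xs y ≤ φ xs ys ∧ φ xs ys ≤ φ x ys

/-! ### Time-varying communication networks -/

/-- A time-varying weighted digraph, with self-loops, on the agents `Fin n₁` of the first and
`Fin n₂` of the second subnetwork. `weight k i j` is the weight `a_{ij}(k) ≥ 0` of the arc `(j, i)`;
the arc is present at time `k` exactly when the weight is positive. -/
structure CommNetwork (n₁ n₂ : ℕ) where
  weight : ℕ → Matrix (Fin n₁ ⊕ Fin n₂) (Fin n₁ ⊕ Fin n₂) ℝ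
  weight_nonneg : ∀ k i j, 0 ≤ weight k i j
  self_loop : ∀ k i, 0 < weight k i i

/-- The digraph with arc set `⋃_{k₁ ≤ s < k₂} E(s)`. -/
def unionArc {V : Type*} (E : ℕ → V → V → Prop) (k₁ k₂ : ℕ) (u v : V) : Prop :=
  ∃ s, k₁ ≤ s ∧ s < k₂ ∧ E s u v

/-- Strong connectivity: there is a directed path from every node to every node. -/
def StronglyConnected {V : Type*} (R : V → V → Prop) : Prop :=
  ∀ u v, Relation.ReflTransGen R u v

/-- Uniformly jointly strongly connected digraph sequences. -/
def UJSC {V : Type*} (E : ℕ → V → V → Prop) : Prop :=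
  ∃ T : ℕ, 0 < T ∧ ∀ k, StronglyConnected (unionArc E k (k + T))

/-- `R` is bipartite with respect to the two subnetworks, and every node receives an arc from the
other subnetwork. -/
def BipartiteNoIsolated {V₁ V₂ : Type*} (R : V₁ ⊕ V₂ → V₁ ⊕ V₂ → Prop) : Prop :=
  (∀ u v, R u v → u.isLeft ≠ v.isLeft) ∧
  (∀ i : V₁, ∃ j : V₂, R (Sum.inr j) (Sum.inl i)) ∧
  (∀ i : V₂, ∃ j : V₁, R (Sum.inl j) (Sum.inr i))

/-- The transition matrix `Φ(r, s) = A(r) A(r-1) ⋯ A(s)` for `r ≥ s` (the identity for `r < s`). -/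
noncomputable def transition {n : ℕ} (A : ℕ → Matrix (Fin n) (Fin n) ℝ) :
    ℕ → ℕ → Matrix (Fin n) (Fin n) ℝ
  | 0, s => if s = 0 then A 0 else 1
  | r + 1, s => if s ≤ r + 1 then A (r + 1) * transition A r s else 1

/-- `v` is a positive stochastic vector with `lim_{r → ∞} Φ(r, s) = 𝟏 vᵀ`; in particular `v` is the
Perron vector of that limit. -/
def IsLimitVector {n : ℕ} (A : ℕ → Matrix (Fin n) (Fin n) ℝ) (s : ℕ) (v : Fin n → ℝ) : Prop :=
  (∀ i, 0 < v i) ∧ ∑ i, v i = 1 ∧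
  Tendsto (fun r => transition A r s) atTop (𝓝 (Matrix.vecMulVec 1 v))

namespace CommNetwork

variable {n₁ n₂ : ℕ} (N : CommNetwork n₁ n₂)

/-- `(j, i)` is an arc at time `k`, i.e. `j` is a neighbor of `i`. -/
def Arc (k : ℕ) (j i : Fin n₁ ⊕ Fin n₂) : Prop := 0 < N.weight k i j

/-- The adjacency matrix `A₁(k)` of the first subnetwork. -/
def A₁ (k : ℕ) : Matrix (Fin n₁) (Fin n₁) ℝ := (N.weight k).toBlocks₁₁

/-- The adjacency matrix `A₂(k)` of the second subnetwork. -/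
def A₂ (k : ℕ) : Matrix (Fin n₂) (Fin n₂) ℝ := (N.weight k).toBlocks₂₂

/-- The weights with which agents of the first subnetwork receive from the second one. -/
def C₁ (k : ℕ) : Matrix (Fin n₁) (Fin n₂) ℝ := (N.weight k).toBlocks₁₂

/-- The weights with which agents of the second subnetwork receive from the first one. -/
def C₂ (k : ℕ) : Matrix (Fin n₂) (Fin n₁) ℝ := (N.weight k).toBlocks₂₁

/-- The arcs of the first subnetwork. -/
def Arc₁ (k : ℕ) (j i : Fin n₁) : Prop := N.Arc k (Sum.inl j) (Sum.inl i)

/-- The arcs of the second subnetwork. -/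
def Arc₂ (k : ℕ) (j i : Fin n₂) : Prop := N.Arc k (Sum.inr j) (Sum.inr i)

/-- The arcs between the two subnetworks. -/
def interArc (k : ℕ) (j i : Fin n₁ ⊕ Fin n₂) : Prop := j.isLeft ≠ i.isLeft ∧ N.Arc k j i

/-- Agent `i` of the first subnetwork has a neighbor in the second one at time `k`. -/
def Contact₁ (k : ℕ) (i : Fin n₁) : Prop := ∃ j, N.Arc k (Sum.inr j) (Sum.inl i)

/-- Agent `i` of the second subnetwork has a neighbor in the first one at time `k`. -/
def Contact₂ (k : ℕ) (i : Fin n₂) : Prop := ∃ j, N.Arc k (Sum.inl j) (Sum.inr i)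

/-- Connectivity: the interconnection is uniformly jointly bipartite without isolated nodes, and
both subnetworks are uniformly jointly strongly connected. -/
def Connectivity : Prop :=
  (∃ T : ℕ, 0 < T ∧ ∀ k, BipartiteNoIsolated (unionArc N.interArc k (k + T))) ∧
  UJSC N.Arc₁ ∧ UJSC N.Arc₂

/-- Weight rule. Weights vanish off the arcs, so the sums over all agents of a subnetwork are sums
over neighbors. -/
def WeightRule : Prop :=
  (∃ η : ℝ, 0 < η ∧ η < 1 ∧ ∀ k i j, N.Arc k j i → η ≤ N.weight k i j) ∧
  ((∀ k i, ∑ j, N.A₁ k i j = 1) ∧ (∀ k i, ∑ j, N.A₂ k i j = 1)) ∧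
  ((∀ k i, N.Contact₁ k i → ∑ j, N.C₁ k i j = 1) ∧
    (∀ k i, N.Contact₂ k i → ∑ j, N.C₂ k i j = 1))

end CommNetwork

/-! ### The game, the algorithm and its convergence -/

/-- Existence of saddle points, for all weightings of the objectives by a stochastic vector. -/
def SaddleExistence {n₁ m₁ m₂ : ℕ} (X : Set (RVec m₁)) (Y : Set (RVec m₂))
    (f : Fin n₁ → RVec m₁ → RVec m₂ → ℝ) : Prop :=
  ∀ μ : Fin n₁ → ℝ, (∀ i, 0 ≤ μ i) → ∑ i, μ i = 1 →
    ∃ xs ys, IsSaddlePoint X Y (fun x y => ∑ i, μ i * f i x y) xs ys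

/-- Boundedness of subgradients on `X × Y`. -/
def BoundedSubgradients {n₁ n₂ m₁ m₂ : ℕ} (X : Set (RVec m₁)) (Y : Set (RVec m₂))
    (f : Fin n₁ → RVec m₁ → RVec m₂ → ℝ) (g : Fin n₂ → RVec m₁ → RVec m₂ → ℝ) : Prop :=
  ∃ L : ℝ, 0 < L ∧ ∀ x ∈ X, ∀ y ∈ Y,
    (∀ i, ∀ q ∈ convexSubdiff (fun x' => f i x' y) x, ‖q‖ ≤ L) ∧
    (∀ j, ∀ q ∈ concaveSubdiff (fun y' => g j x y') y, ‖q‖ ≤ L)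

/-- `x`, `y` are states generated by the algorithm with stepsizes `α k i`, `β k i`, from
the initial states `x 0`, `y 0`. Here `xb k i`, `yb k i` is the information that an agent holds about
the other subnetwork: the weighted average received at its last contact time `s ≤ k`; as long as the
agent has had no contact at all, it is an arbitrary point. -/
def IsTrajectory {n₁ n₂ m₁ m₂ : ℕ} (N : CommNetwork n₁ n₂)
    (X : Set (RVec m₁)) (Y : Set (RVec m₂))
    (f : Fin n₁ → RVec m₁ → RVec m₂ → ℝ) (g : Fin n₂ → RVec m₁ → RVec m₂ → ℝ)
    (α : ℕ → Fin n₁ → ℝ) (β : ℕ → Fin n₂ → ℝ)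
    (x : ℕ → Fin n₁ → RVec m₁) (y : ℕ → Fin n₂ → RVec m₂) : Prop :=
  ∃ (xb : ℕ → Fin n₁ → RVec m₂) (yb : ℕ → Fin n₂ → RVec m₁),
    (∀ k i s, IsGreatest {t | t ≤ k ∧ N.Contact₁ t i} s →
      xb k i = ∑ j, N.C₁ s i j • y s j) ∧
    (∀ k i s, IsGreatest {t | t ≤ k ∧ N.Contact₂ t i} s →
      yb k i = ∑ j, N.C₂ s i j • x s j) ∧
    (∀ k i, ∃ q ∈ convexSubdiff (fun x' => f i x' (xb k i)) (∑ j, N.A₁ k i j • x k j),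
      IsProjection X (∑ j, N.A₁ k i j • x k j - α k i • q) (x (k + 1) i)) ∧
    (∀ k i, ∃ q ∈ concaveSubdiff (fun y' => g i (yb k i) y') (∑ j, N.A₂ k i j • y k j),
      IsProjection Y (∑ j, N.A₂ k i j • y k j + β k i • q) (y (k + 1) i))

/-- The network achieves a Nash equilibrium: whatever the initial states (and whatever subgradients
are selected), all states of each subnetwork converge to a common limit, and the two limits form
a saddle point of the sum objective. -/
def AchievesNash {n₁ n₂ m₁ m₂ : ℕ} (N : CommNetwork n₁ n₂)
    (X : Set (RVec m₁)) (Y : Set (RVec m₂))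
    (f : Fin n₁ → RVec m₁ → RVec m₂ → ℝ) (g : Fin n₂ → RVec m₁ → RVec m₂ → ℝ)
    (α : ℕ → Fin n₁ → ℝ) (β : ℕ → Fin n₂ → ℝ) : Prop :=
  ∀ x y, IsTrajectory N X Y f g α β x y →
    ∃ xs ys, IsSaddlePoint X Y (fun x' y' => ∑ i, f i x' y') xs ys ∧
      (∀ i, Tendsto (fun k => x k i) atTop (𝓝 xs)) ∧
      (∀ i, Tendsto (fun k => y k i) atTop (𝓝 ys))

/-- The conditions on the base stepsizes `γ_k`. -/
def BaseStepsize (γ : ℕ → ℝ) : Prop :=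
  (∀ k, 0 < γ k) ∧
  Tendsto (fun k => γ k * ∑ s ∈ Finset.range k, γ s) atTop (𝓝 0) ∧
  Antitone γ ∧
  Tendsto (fun k => ∑ s ∈ Finset.range k, γ s) atTop atTop ∧
  Summable fun k => γ k ^ 2

/-!
For each subnetwork the limits of the backward products of the weight matrices form an absolute
probability sequence `φ`, that is `φ (k + 1) ᵥ* A k = φ k`, whose entries are bounded away from
zero. With the stepsizes `γ k / φ (k + 1) i`, which compensate the imbalance of the weights, the
`φ`-weighted means `x̄`, `ȳ` of the states follow, up to errors, a centralised projected
subgradient iteration with stepsize `γ k` for `U`. Let `V` be the sum over both subnetworks of the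
`φ`-weighted mean squared distances to a saddle point `(x*, y*)`. Then
`V (k + 1) ≤ V k - 2 γ k (U(x̄, y*) - U(x*, ȳ)) + C γ k e k (1 + V k) + C γ k ^ 2`,
where `e k` bounds the disagreement inside the subnetworks and the effect of outdated information.
The factor `1 + V k` is there because the bounded subgradients make an individual `f i` Lipschitz
in its own variable only; in the opponent's variable its Lipschitz constant may grow with the
distance from the saddle point. Since long products of the weight matrices contract the
disagreement, `∑ γ k e k < ∞`, so by the Robbins-Siegmund argument `V` converges and
`∑ γ k (U(x̄, y*) - U(x*, ȳ)) < ∞`. As `∑ γ k = ∞`, the saddle gap and `e` vanish along a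
subsequence; strict convexity-concavity then forces `x̄ → x*` and `ȳ → y*` there, so the limit of
`V` is zero.
-/

/-! ### Real sequences -/

section RealSequences

variable {V a b c : ℕ → ℝ}

theorem summable_of_block_contraction {u : ℕ → ℝ} {ρ : ℝ} {B : ℕ} (hu : ∀ k, 0 ≤ u k)
    (hc : ∀ k, 0 ≤ c k) (hρ : ρ < 1) (hsum : Summable c)
    (hblock : ∀ k, u (k + B) ≤ ρ * u k + c k) : Summable u := by
  refine summable_of_sum_range_le (c := (∑ k ∈ Finset.range B, u k + ∑' k, c k) / (1 - ρ)) hu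
    fun n => ?_
  rw [le_div_iff₀ (sub_pos.2 hρ)]
  have hsplit : ∑ k ∈ Finset.range n, u k ≤
      ∑ k ∈ Finset.range B, u k + ∑ k ∈ Finset.range n, u (k + B) :=
    calc ∑ k ∈ Finset.range n, u k
      _ ≤ ∑ k ∈ Finset.range (B + n), u k :=
        Finset.sum_le_sum_of_subset_of_nonneg (Finset.range_mono (by lia)) fun i _ _ => hu i
      _ = ∑ k ∈ Finset.range B, u k + ∑ k ∈ Finset.range n, u (k + B) := by
        simp only [Finset.sum_range_add, add_comm]
  have hcontract : ∑ k ∈ Finset.range n, u (k + B) ≤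
      ρ * ∑ k ∈ Finset.range n, u k + ∑ k ∈ Finset.range n, c k := by
    rw [Finset.mul_sum, ← Finset.sum_add_distrib]
    exact Finset.sum_le_sum fun k _ => hblock k
  linarith [hsum.sum_le_tsum (Finset.range n) fun k _ => hc k]

theorem tendsto_and_summable_of_le_sub_add (hV : ∀ k, 0 ≤ V k) (hb : ∀ k, 0 ≤ b k)
    (hc : ∀ k, 0 ≤ c k) (hcsum : Summable c) (hstep : ∀ k, V (k + 1) ≤ V k - b k + c k) :
    (∃ l, Tendsto V atTop (𝓝 l)) ∧ Summable b := by
  have hcle : ∀ n, ∑ k ∈ Finset.range n, c k ≤ ∑' k, c k := fun n =>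
    hcsum.sum_le_tsum _ fun k _ => hc k
  constructor
  · let W : ℕ → ℝ := fun k => V k - ∑ j ∈ Finset.range k, c j
    have hWanti : Antitone W := antitone_nat_of_succ_le fun k => by
      simp only [W, Finset.sum_range_succ]
      linarith [hstep k, hb k]
    have hWbelow : BddBelow (Set.range W) :=
      ⟨-∑' j, c j, Set.forall_mem_range.2 fun k => by linarith [hV k, hcle k]⟩
    exact ⟨_, ((tendsto_atTop_ciInf hWanti hWbelow).add hcsum.hasSum.tendsto_sum_nat).congr
      fun k => sub_add_cancel _ _⟩
  · refine summable_of_sum_range_le (c := V 0 + ∑' j, c j) hb fun n => ?_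
    have htelescope : ∑ k ∈ Finset.range n, b k ≤ V 0 - V n + ∑ k ∈ Finset.range n, c k := by
      induction n with
      | zero => simp
      | succ n ih =>
        rw [Finset.sum_range_succ, Finset.sum_range_succ]
        linarith [hstep n]
    linarith [hcle n, hV n]

/-- The deterministic Robbins–Siegmund lemma. -/
theorem tendsto_and_summable_of_le_one_add_mul_sub_add (hV : ∀ k, 0 ≤ V k) (ha : ∀ k, 0 ≤ a k)
    (hb : ∀ k, 0 ≤ b k) (hc : ∀ k, 0 ≤ c k) (hasum : Summable a) (hcsum : Summable c)
    (hstep : ∀ k, V (k + 1) ≤ (1 + a k) * V k - b k + c k) :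
    (∃ l, Tendsto V atTop (𝓝 l)) ∧ Summable b := by
  let M := (V 0 + ∑' j, c j) * Real.exp (∑' j, a j)
  have hVM : ∀ k, V k ≤ M := fun k =>
    calc V k
      _ ≤ (V 0 + ∑ j ∈ Finset.Ico 0 k, c j) * Real.exp (∑ j ∈ Finset.Ico 0 k, a j) :=
        discrete_gronwall (hV 0) (fun n _ => by linarith [hstep n, hb n]) (fun n _ => ha n)
          (fun n _ => hc n) k.zero_le
      _ ≤ M := by
        have := hasum.sum_le_tsum (Finset.Ico 0 k) fun j _ => ha j
        have := hcsum.sum_le_tsum (Finset.Ico 0 k) fun j _ => hc j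
        have : 0 ≤ V 0 + ∑' j, c j := add_nonneg (hV 0) (tsum_nonneg hc)
        simp only [M]
        gcongr
  refine tendsto_and_summable_of_le_sub_add hV hb (c := fun k => M * a k + c k)
    (fun k => add_nonneg (mul_nonneg ((hV 0).trans (hVM 0)) (ha k)) (hc k))
    ((hasum.mul_left M).add hcsum) fun k => ?_
  linarith [hstep k, mul_le_mul_of_nonneg_right (hVM k) (ha k)]

variable {γ w : ℕ → ℝ}

theorem frequently_lt_of_summable_mul (hγ : ∀ k, 0 < γ k)
    (hdiv : Tendsto (fun k => ∑ s ∈ Finset.range k, γ s) atTop atTop)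
    (hsum : Summable fun k => γ k * w k) {ε : ℝ} (hε : 0 < ε) : ∃ᶠ k in atTop, w k < ε := by
  intro hlarge
  have hdom : ∀ᶠ k in atTop, ‖γ k‖ ≤ ε⁻¹ * (γ k * w k) := by
    filter_upwards [hlarge] with k hk
    rw [Real.norm_of_nonneg (hγ k).le, inv_mul_eq_div, le_div_iff₀ hε]
    exact mul_le_mul_of_nonneg_left (not_lt.1 hk) (hγ k).le
  have hγsum : Summable γ := (hsum.mul_left ε⁻¹).of_norm_bounded_eventually_nat hdom
  exact not_tendsto_atTop_of_tendsto_nhds hγsum.hasSum.tendsto_sum_nat hdiv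

theorem summable_mul_comp_sub (hγ : ∀ k, 0 ≤ γ k) (hanti : Antitone γ) (hw : ∀ k, 0 ≤ w k)
    (hsum : Summable fun k => γ k * w k) (t : ℕ) : Summable fun k => γ k * w (k - t) := by
  rw [← summable_nat_add_iff t]
  refine Summable.of_nonneg_of_le (fun k => mul_nonneg (hγ _) (hw _)) (fun k => ?_) hsum
  rw [Nat.add_sub_cancel]
  exact mul_le_mul_of_nonneg_right (hanti (Nat.le_add_right k t)) (hw k)

theorem tendsto_and_exists_subseq_of_descent {V gap e γ : ℕ → ℝ} {C : ℝ} (hV : ∀ k, 0 ≤ V k)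
    (hγ : ∀ k, 0 < γ k) (hC : 0 ≤ C) (he : ∀ k, 0 ≤ e k)
    (hdiv : Tendsto (fun k => ∑ s ∈ Finset.range k, γ s) atTop atTop)
    (hsq : Summable fun k => γ k ^ 2) (hse : Summable fun k => γ k * e k)
    (hgap : ∀ᶠ k in atTop, 0 ≤ gap k)
    (hdesc : ∀ᶠ k in atTop, V (k + 1) ≤
      V k - 2 * γ k * gap k + C * (γ k * e k) * (1 + V k) + C * γ k ^ 2) :
    (∃ l, Tendsto V atTop (𝓝 l)) ∧ ∃ ψ : ℕ → ℕ, StrictMono ψ ∧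
      Tendsto (fun k => gap (ψ k)) atTop (𝓝 0) ∧ Tendsto (fun k => e (ψ k)) atTop (𝓝 0) := by
  obtain ⟨K, hK⟩ := eventually_atTop.1 (hgap.and hdesc)
  have hseK := (summable_nat_add_iff K).2 hse
  have hsqK := (summable_nat_add_iff K).2 hsq
  have hCγe : ∀ k, 0 ≤ C * (γ k * e k) := fun k => mul_nonneg hC (mul_nonneg (hγ k).le (he k))
  obtain ⟨⟨l, hl⟩, hgapsum⟩ := tendsto_and_summable_of_le_one_add_mul_sub_add
    (V := fun k => V (k + K)) (a := fun k => C * (γ (k + K) * e (k + K)))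
    (b := fun k => 2 * γ (k + K) * gap (k + K))
    (c := fun k => C * (γ (k + K) * e (k + K)) + C * γ (k + K) ^ 2)
    (fun k => hV _) (fun k => hCγe _)
    (fun k => mul_nonneg (by linarith [hγ (k + K)]) (hK _ (Nat.le_add_left K k)).1)
    (fun k => add_nonneg (hCγe _) (by positivity))
    (hseK.mul_left C) ((hseK.mul_left C).add (hsqK.mul_left C))
    (fun k => by
      have hstep := (hK _ (Nat.le_add_left K k)).2
      rw [show k + 1 + K = k + K + 1 by lia]
      linarith)
  refine ⟨⟨l, (tendsto_add_atTop_iff_nat K).1 hl⟩, ?_⟩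
  have hsum : Summable fun k => γ k * (gap k + e k) := by
    rw [← summable_nat_add_iff K]
    exact ((hgapsum.mul_left (1 / 2)).add hseK).congr fun k => by ring
  obtain ⟨ψ, hψ, hsmall⟩ := extraction_forall_of_frequently fun n : ℕ =>
    (frequently_lt_of_summable_mul hγ hdiv hsum
      (Nat.one_div_pos_of_nat (n := n))).and_eventually hgap
  have hzero := tendsto_one_div_add_atTop_nhds_zero_nat (𝕜 := ℝ)
  exact ⟨ψ, hψ,
    squeeze_zero (fun n => (hsmall n).2) (fun n => by linarith [(hsmall n).1, he (ψ n)]) hzero,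
    squeeze_zero (fun n => he _) (fun n => by linarith [hsmall n]) hzero⟩

end RealSequences

/-! ### Spread and weighted means of a family -/

section Spread

variable {ι E : Type*} [NormedAddCommGroup E]

/-- The diameter of a family of points, which measures the disagreement of the agents. -/
noncomputable def spread (x : ι → E) : ℝ := Metric.diam (Set.range x)

theorem spread_nonneg (x : ι → E) : 0 ≤ spread x := Metric.diam_nonneg

theorem spread_le {x : ι → E} {d : ℝ} (hd : 0 ≤ d) (h : ∀ i j, ‖x i - x j‖ ≤ d) :
    spread x ≤ d := by
  refine Metric.diam_le_of_forall_dist_le hd ?_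
  rintro _ ⟨i, rfl⟩ _ ⟨j, rfl⟩
  simpa only [dist_eq_norm] using h i j

variable [NormedSpace ℝ E] [Finite ι]

theorem norm_sub_le_spread_of_mem_convexHull {x : ι → E} {u v : E}
    (hu : u ∈ convexHull ℝ (Set.range x)) (hv : v ∈ convexHull ℝ (Set.range x)) :
    ‖u - v‖ ≤ spread x := by
  rw [← dist_eq_norm, spread, ← convexHull_diam]
  exact Metric.dist_le_diam_of_mem (isBounded_convexHull.2 (Set.finite_range x).isBounded) hu hv

theorem norm_sub_le_spread (x : ι → E) (i j : ι) : ‖x i - x j‖ ≤ spread x :=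
  norm_sub_le_spread_of_mem_convexHull (subset_convexHull ℝ _ ⟨i, rfl⟩)
    (subset_convexHull ℝ _ ⟨j, rfl⟩)

end Spread

section WeightedMean

variable {ι E : Type*} [Fintype ι] [NormedAddCommGroup E] [NormedSpace ℝ E]

/-- The mean of a family of vectors with respect to (not necessarily normalised) weights `p`. -/
def weightedMean (p : ι → ℝ) (x : ι → E) : E := ∑ i, p i • x i

/-- The family of weighted means given by the rows of `Q`: one round of averaging of the states `x`
over a network with weight matrix `Q`. -/
def averaging (Q : Matrix ι ι ℝ) (x : ι → E) : ι → E := fun i => weightedMean (Q i) x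

theorem weightedMean_sub (p : ι → ℝ) (x y : ι → E) :
    weightedMean p (x - y) = weightedMean p x - weightedMean p y := by
  simp only [weightedMean, Pi.sub_apply, smul_sub, Finset.sum_sub_distrib]

theorem averaging_sub (Q : Matrix ι ι ℝ) (x y : ι → E) :
    averaging Q (x - y) = averaging Q x - averaging Q y :=
  funext fun i => weightedMean_sub (Q i) x y

theorem weightedMean_averaging (p : ι → ℝ) (Q : Matrix ι ι ℝ) (x : ι → E) :
    weightedMean p (averaging Q x) = weightedMean (Matrix.vecMul p Q) x := by
  simp only [weightedMean, averaging, Matrix.vecMul, dotProduct, Finset.smul_sum, smul_smul,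
    Finset.sum_smul]
  exact Finset.sum_comm

theorem averaging_mul (P Q : Matrix ι ι ℝ) (x : ι → E) :
    averaging (P * Q) x = averaging P (averaging Q x) :=
  funext fun i => by
    simp only [averaging, Matrix.mul_apply_eq_vecMul, ← weightedMean_averaging]

theorem averaging_one [DecidableEq ι] (x : ι → E) : averaging 1 x = x := by
  ext i
  simp [averaging, weightedMean, Matrix.one_apply]

theorem weightedMean_mem_convexHull {p : ι → ℝ} (hp : p ∈ stdSimplex ℝ ι) (x : ι → E) :
    weightedMean p x ∈ convexHull ℝ (Set.range x) :=
  mem_convexHull_of_exists_fintype p x hp.1 hp.2 (fun i => ⟨i, rfl⟩) rfl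

theorem weightedMean_mem {p : ι → ℝ} (hp : p ∈ stdSimplex ℝ ι) {K : Set E} (hK : Convex ℝ K)
    {x : ι → E} (hx : ∀ i, x i ∈ K) : weightedMean p x ∈ K :=
  convexHull_min (Set.range_subset_iff.2 hx) hK (weightedMean_mem_convexHull hp x)

theorem norm_weightedMean_le {p : ι → ℝ} (hp : p ∈ stdSimplex ℝ ι) (x : ι → E) :
    ‖weightedMean p x‖ ≤ ‖x‖ :=
  mem_closedBall_zero_iff.1 <| weightedMean_mem hp (convex_closedBall 0 ‖x‖) fun i =>
    mem_closedBall_zero_iff.2 (norm_le_pi_norm x i)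

theorem spread_le_spread_add (x y : ι → E) : spread x ≤ spread y + 2 * ‖x - y‖ := by
  refine spread_le (add_nonneg (spread_nonneg y) (by positivity)) fun i j => ?_
  calc ‖x i - x j‖
    _ = ‖(x - y) i + (y i - y j) - (x - y) j‖ := by
      congr 1
      simp only [Pi.sub_apply]
      abel
    _ ≤ ‖(x - y) i‖ + ‖y i - y j‖ + ‖(x - y) j‖ :=
      norm_sub_le_of_le (norm_add_le _ _) le_rfl
    _ ≤ spread y + 2 * ‖x - y‖ := by
      linarith [norm_le_pi_norm (x - y) i, norm_le_pi_norm (x - y) j, norm_sub_le_spread y i j]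

theorem norm_weightedMean_sub_weightedMean_le {p q : ι → ℝ} {m : ℝ} (hp : 0 ≤ p) (hq : 0 ≤ q)
    (hpm : ∑ i, p i = m) (hqm : ∑ i, q i = m) (x : ι → E) :
    ‖weightedMean p x - weightedMean q x‖ ≤ m * spread x := by
  have hm : 0 ≤ m := hpm ▸ Finset.sum_nonneg fun i _ => hp i
  rcases hm.eq_or_lt with rfl | hmpos
  · have hp0 : p = 0 := (Fintype.sum_eq_zero_iff_of_nonneg hp).1 hpm
    have hq0 : q = 0 := (Fintype.sum_eq_zero_iff_of_nonneg hq).1 hqm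
    simp [hp0, hq0]
  · have hnormalise : ∀ r : ι → ℝ, 0 ≤ r → ∑ i, r i = m →
        ∃ r' ∈ stdSimplex ℝ ι, weightedMean r x = m • weightedMean r' x := fun r hr hrm => by
      refine ⟨m⁻¹ • r, ⟨fun i => mul_nonneg (inv_nonneg.2 hm) (hr i), ?_⟩, ?_⟩
      · simp only [Pi.smul_apply, smul_eq_mul, ← Finset.mul_sum, hrm, inv_mul_cancel₀ hmpos.ne']
      · simp only [weightedMean, Finset.smul_sum, smul_smul, Pi.smul_apply, smul_eq_mul,
          mul_inv_cancel_left₀ hmpos.ne']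
    obtain ⟨p', hp', hpp'⟩ := hnormalise p hp hpm
    obtain ⟨q', hq', hqq'⟩ := hnormalise q hq hqm
    rw [hpp', hqq', ← smul_sub, norm_smul, Real.norm_of_nonneg hm]
    exact mul_le_mul_of_nonneg_left (norm_sub_le_spread_of_mem_convexHull
      (weightedMean_mem_convexHull hp' x) (weightedMean_mem_convexHull hq' x)) hm

variable [DecidableEq ι] {Q : Matrix ι ι ℝ}

theorem row_mem_stdSimplex (hQ : Q ∈ Matrix.rowStochastic ℝ ι) (i : ι) : Q i ∈ stdSimplex ℝ ι :=
  ⟨fun _ => Matrix.nonneg_of_mem_rowStochastic hQ, Matrix.sum_row_of_mem_rowStochastic hQ i⟩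

theorem norm_averaging_le (hQ : Q ∈ Matrix.rowStochastic ℝ ι) (x : ι → E) :
    ‖averaging Q x‖ ≤ ‖x‖ :=
  (pi_norm_le_iff_of_nonneg (norm_nonneg x)).2 fun i =>
    norm_weightedMean_le (row_mem_stdSimplex hQ i) x

/- Any two rows share the mass `c` at every column; removing it from one column leaves two
nonnegative combinations of mass `1 - c`. -/
theorem spread_averaging_le [Nonempty ι] (hQ : Q ∈ Matrix.rowStochastic ℝ ι) {c : ℝ} (hc0 : 0 ≤ c)
    (hc : ∀ i j, c ≤ Q i j) (x : ι → E) : spread (averaging Q x) ≤ (1 - c) * spread x := by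
  have hrest : ∀ i k, 0 ≤ Q i - (Pi.single k c : ι → ℝ) := fun i k l => by
    rcases eq_or_ne l k with rfl | hlk
    · simpa using hc i l
    · simpa [hlk] using hc0.trans (hc i l)
  have hmass : ∀ i k, ∑ l, (Q i l - (Pi.single k c : ι → ℝ) l) = 1 - c := fun i k => by
    simp [Finset.sum_sub_distrib, (row_mem_stdSimplex hQ i).2]
  have hc1 : 0 ≤ 1 - c := by
    rw [← hmass (Classical.arbitrary ι) (Classical.arbitrary ι)]
    exact Finset.sum_nonneg fun l _ => hrest _ _ l
  refine spread_le (mul_nonneg hc1 (spread_nonneg x)) fun i j => ?_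
  have h := norm_weightedMean_sub_weightedMean_le (hrest i i) (hrest j i) (hmass i i) (hmass j i) x
  simpa [averaging, weightedMean, sub_smul, Finset.sum_sub_distrib] using h

end WeightedMean

/-! ### Products of stochastic matrices -/

/-- The backward product `A (s + m - 1) * ⋯ * A s` of `m` consecutive terms, i.e. the transition
matrix `Φ(s + m - 1, s)`, indexed by its length so that the empty product is unambiguous. -/
def blockProd {M : Type*} [Monoid M] (A : ℕ → M) (s : ℕ) : ℕ → M
  | 0 => 1
  | m + 1 => A (s + m) * blockProd A s m

section BlockProd

variable {M : Type*} [Monoid M] (A : ℕ → M)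

theorem blockProd_add (s m l : ℕ) :
    blockProd A s (m + l) = blockProd A (s + m) l * blockProd A s m := by
  induction l with
  | zero => simp [blockProd]
  | succ l ih => rw [← add_assoc, blockProd, ih, blockProd, mul_assoc, add_assoc]

theorem blockProd_succ' (s m : ℕ) : blockProd A s (m + 1) = blockProd A (s + 1) m * A s := by
  rw [add_comm, blockProd_add]
  simp [blockProd]

theorem blockProd_shift (r s m : ℕ) :
    blockProd (fun k => A (r + k)) s m = blockProd A (r + s) m := by
  induction m with
  | zero => rfl
  | succ m ih => rw [blockProd, blockProd, ih, add_assoc]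

variable {A} in
theorem blockProd_mem {S : Submonoid M} (hA : ∀ k, A k ∈ S) (s m : ℕ) : blockProd A s m ∈ S := by
  induction m with
  | zero => exact S.one_mem
  | succ m ih => exact S.mul_mem (hA _) ih

theorem transition_of_lt {n : ℕ} (A : ℕ → Matrix (Fin n) (Fin n) ℝ) {r s : ℕ} (h : r < s) :
    transition A r s = 1 := by
  cases r with
  | zero => rw [transition, if_neg (by lia)]
  | succ r => rw [transition, if_neg (by lia)]

theorem transition_add {n : ℕ} (A : ℕ → Matrix (Fin n) (Fin n) ℝ) (s m : ℕ) :
    transition A (m + s) s = blockProd A s (m + 1) := by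
  induction m with
  | zero =>
    cases s with
    | zero => simp [transition, blockProd]
    | succ s => simp [transition, blockProd, transition_of_lt A (Nat.lt_succ_self s)]
  | succ m ih =>
    rw [show m + 1 + s = (m + s) + 1 by lia, transition, if_pos (by lia), ih,
      blockProd.eq_2 A s (m + 1), show m + s + 1 = s + (m + 1) by lia]

end BlockProd

section Mixing

variable {ι : Type*} [Fintype ι] [DecidableEq ι] {A : ℕ → Matrix ι ι ℝ}

/-- A sequence of row stochastic matrices all of whose block products of length `B` have entries at
least `c > 0`. -/
structure IsUniformlyMixing (A : ℕ → Matrix ι ι ℝ) (B : ℕ) (c : ℝ) : Prop where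
  mem_rowStochastic : ∀ k, A k ∈ Matrix.rowStochastic ℝ ι
  pos : 0 < c
  le_blockProd : ∀ s i j, c ≤ blockProd A s B i j

theorem StronglyConnected.exists_arc {V : Type*} {R : V → V → Prop} (hR : StronglyConnected R)
    {S : Set V} {u v : V} (hu : u ∈ S) (hv : v ∉ S) : ∃ a b, R a b ∧ a ∈ S ∧ b ∉ S := by
  by_contra! hclosed
  have hreach : ∀ w, Relation.ReflTransGen R u w → w ∈ S := fun w huw => by
    induction huw with
    | refl => exact hu
    | tail _ hab ih => exact hclosed _ _ hab ih
  exact hv (hreach v (hR u v))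

theorem eq_univ_of_strict_growth {V : Type*} [Fintype V] {R : ℕ → Finset V} (hmono : Monotone R)
    {T : ℕ} (hgrow : ∀ m, R m ≠ Finset.univ → R m ≠ R (m + T)) :
    R (Fintype.card V * T) = Finset.univ := by
  have hcard : ∀ w, min (Fintype.card V) w ≤ (R (w * T)).card := fun w => by
    induction w with
    | zero => simp
    | succ w ih =>
      rw [add_one_mul]
      have hsub : R (w * T) ⊆ R (w * T + T) := hmono (Nat.le_add_right _ _)
      by_cases hfull : R (w * T) = Finset.univ
      · have hfull' : R (w * T + T) = Finset.univ := Finset.univ_subset_iff.1 (hfull ▸ hsub)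
        rw [hfull', Finset.card_univ]
        exact min_le_left _ _
      · have := Finset.card_lt_card (hsub.ssubset_of_ne (hgrow _ hfull))
        lia
  rw [← Finset.card_eq_iff_eq_univ]
  exact le_antisymm (Finset.card_le_univ _) (by simpa using hcard (Fintype.card V))

theorem pow_succ_le_blockProd (hA : ∀ k, A k ∈ Matrix.rowStochastic ℝ ι) {η : ℝ} (hη : 0 ≤ η)
    {s m : ℕ} {i j l : ι} (hl : η ^ m ≤ blockProd A s m l j) (hil : η ≤ A (s + m) i l) :
    η ^ (m + 1) ≤ blockProd A s (m + 1) i j := by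
  rw [blockProd, Matrix.mul_apply, pow_succ']
  refine (mul_le_mul hil hl (by positivity) (hη.trans hil)).trans ?_
  exact Finset.single_le_sum (f := fun l => A (s + m) i l * blockProd A s m l j)
    (fun k _ => mul_nonneg (Matrix.nonneg_of_mem_rowStochastic (hA _))
      (Matrix.nonneg_of_mem_rowStochastic (blockProd_mem hA s m))) (Finset.mem_univ l)

/- The set of agents that have received at least weight `η ^ m` from `j` after `m` steps never
shrinks, because of the self-loops, and grows in every window of length `T`. -/
theorem pow_le_blockProd (hA : ∀ k, A k ∈ Matrix.rowStochastic ℝ ι) {η : ℝ} (hη : 0 ≤ η)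
    (hdiag : ∀ k i, η ≤ A k i i) {E : ℕ → ι → ι → Prop} (harc : ∀ k i j, E k j i → η ≤ A k i j)
    {T : ℕ} (hconn : ∀ k, StronglyConnected (unionArc E k (k + T))) (s : ℕ) (i j : ι) :
    η ^ (Fintype.card ι * T) ≤ blockProd A s (Fintype.card ι * T) i j := by
  let R : ℕ → Finset ι := fun m => {i | η ^ m ≤ blockProd A s m i j}
  have hR : ∀ {m i}, i ∈ R m ↔ η ^ m ≤ blockProd A s m i j := by simp [R]
  have hmono : Monotone R := monotone_nat_of_le_succ fun m i hi =>
    hR.2 (pow_succ_le_blockProd hA hη (hR.1 hi) (hdiag _ i))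
  have hj : ∀ m, j ∈ R m := fun m => hmono m.zero_le (hR.2 (by simp [blockProd]))
  suffices hgrow : ∀ m, R m ≠ Finset.univ → R m ≠ R (m + T) from
    hR.1 (eq_univ_of_strict_growth hmono hgrow ▸ Finset.mem_univ i)
  intro m hm
  obtain ⟨v, hv⟩ : ∃ v, v ∉ R m := by simpa [Finset.eq_univ_iff_forall] using hm
  obtain ⟨a, b, ⟨t, hst, htT, hE⟩, ha, hb⟩ := (hconn (s + m)).exists_arc (S := R m) (hj m) hv
  obtain ⟨d, rfl⟩ := Nat.exists_eq_add_of_le hst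
  have hbd : b ∈ R (m + d + 1) := by
    have had : a ∈ R (m + d) := hmono (Nat.le_add_right m d) ha
    exact hR.2 (pow_succ_le_blockProd hA hη (hR.1 had) (by simpa [add_assoc] using harc _ _ _ hE))
  exact fun heq => hb (heq ▸ hmono (by lia) hbd)

theorem UJSC.exists_isUniformlyMixing {E : ℕ → ι → ι → Prop} (hE : UJSC E)
    (hA : ∀ k, A k ∈ Matrix.rowStochastic ℝ ι) {η : ℝ} (hη : 0 < η)
    (hdiag : ∀ k i, η ≤ A k i i) (harc : ∀ k i j, E k j i → η ≤ A k i j) :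
    ∃ B c, IsUniformlyMixing A B c := by
  obtain ⟨T, -, hconn⟩ := hE
  exact ⟨_, _, hA, pow_pos hη _, pow_le_blockProd hA hη.le hdiag harc hconn⟩

theorem IsUniformlyMixing.shift {B : ℕ} {c : ℝ} (hA : IsUniformlyMixing A B c) (s : ℕ) :
    IsUniformlyMixing (fun k => A (s + k)) B c where
  mem_rowStochastic k := hA.mem_rowStochastic (s + k)
  pos := hA.pos
  le_blockProd r i j := blockProd_shift A s r B ▸ hA.le_blockProd (s + r) i j

theorem IsUniformlyMixing.le_blockProd_add (hA : IsUniformlyMixing A B c) (s m : ℕ) (i j : ι) :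
    c ≤ blockProd A s (B + m) i j := by
  have hrow := row_mem_stdSimplex (blockProd_mem hA.mem_rowStochastic (s + B) m) i
  rw [blockProd_add, Matrix.mul_apply]
  exact weightedMean_mem hrow (convex_Ici c) fun k => hA.le_blockProd s k j

end Mixing

/-! ### Perturbed consensus -/

section Consensus

variable {ι : Type*} [Fintype ι] {A : ℕ → Matrix ι ι ℝ} {E : Type*} [NormedAddCommGroup E]
  [NormedSpace ℝ E] {x : ℕ → ι → E} {γ δ : ℕ → ℝ}

/-- The states `x` follow the averaging dynamics of `A` up to errors of size `δ k`, in the maximum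
norm over the agents. -/
def IsPerturbedAveraging (A : ℕ → Matrix ι ι ℝ) (δ : ℕ → ℝ) (x : ℕ → ι → E) : Prop :=
  ∀ k, ‖x (k + 1) - averaging (A k) (x k)‖ ≤ δ k

theorem IsPerturbedAveraging.nonneg (hx : IsPerturbedAveraging A δ x) (k : ℕ) : 0 ≤ δ k :=
  (norm_nonneg _).trans (hx k)

variable [DecidableEq ι] {B : ℕ} {c : ℝ}

theorem IsPerturbedAveraging.norm_sub_averaging_blockProd_le (hx : IsPerturbedAveraging A δ x)
    (hA : ∀ k, A k ∈ Matrix.rowStochastic ℝ ι) (hδ : Antitone δ) (k m : ℕ) :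
    ‖x (k + m) - averaging (blockProd A k m) (x k)‖ ≤ m * δ k := by
  induction m with
  | zero => simp [blockProd, averaging_one]
  | succ m ih =>
    have hsplit : x (k + (m + 1)) - averaging (blockProd A k (m + 1)) (x k) =
        x (k + m + 1) - averaging (A (k + m)) (x (k + m)) +
          averaging (A (k + m)) (x (k + m) - averaging (blockProd A k m) (x k)) := by
      rw [averaging_sub, blockProd, averaging_mul, ← add_assoc]
      abel
    calc ‖x (k + (m + 1)) - averaging (blockProd A k (m + 1)) (x k)‖
      _ ≤ δ (k + m) + m * δ k := by
        rw [hsplit]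
        exact norm_add_le_of_le (hx _) ((norm_averaging_le (hA _) _).trans ih)
      _ ≤ δ k + m * δ k := by gcongr; exact hδ (Nat.le_add_right k m)
      _ = (m + 1 : ℕ) * δ k := by push_cast; ring

variable [Nonempty ι]

theorem IsPerturbedAveraging.spread_add_le (hx : IsPerturbedAveraging A δ x)
    (hA : IsUniformlyMixing A B c) (hδ : Antitone δ) (k : ℕ) :
    spread (x (k + B)) ≤ (1 - c) * spread (x k) + 2 * (B * δ k) :=
  calc spread (x (k + B))
    _ ≤ spread (averaging (blockProd A k B) (x k)) +
        2 * ‖x (k + B) - averaging (blockProd A k B) (x k)‖ := spread_le_spread_add _ _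
    _ ≤ (1 - c) * spread (x k) + 2 * (B * δ k) := by
      gcongr
      · exact spread_averaging_le (blockProd_mem hA.mem_rowStochastic k B) hA.pos.le
          (hA.le_blockProd k) (x k)
      · exact hx.norm_sub_averaging_blockProd_le hA.mem_rowStochastic hδ k B

theorem IsPerturbedAveraging.summable_mul_spread (hx : IsPerturbedAveraging A δ x)
    (hA : IsUniformlyMixing A B c) (hδ : Antitone δ) (hγ : ∀ k, 0 ≤ γ k) (hγanti : Antitone γ)
    (hsum : Summable fun k => γ k * δ k) : Summable fun k => γ k * spread (x k) := by
  refine summable_of_block_contraction (c := fun k => 2 * B * (γ k * δ k)) (ρ := 1 - c) (B := B)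
    (fun k => mul_nonneg (hγ k) (spread_nonneg _))
    (fun k => mul_nonneg (by positivity) (mul_nonneg (hγ k) (hx.nonneg k)))
    (by linarith [hA.pos]) (hsum.mul_left _) fun k => ?_
  calc γ (k + B) * spread (x (k + B))
    _ ≤ γ k * ((1 - c) * spread (x k) + 2 * (B * δ k)) :=
      mul_le_mul (hγanti (Nat.le_add_right k B)) (hx.spread_add_le hA hδ k) (spread_nonneg _) (hγ k)
    _ = (1 - c) * (γ k * spread (x k)) + 2 * B * (γ k * δ k) := by ring

theorem IsUniformlyMixing.exists_tendsto_of_averaging [CompleteSpace E]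
    (hA : IsUniformlyMixing A B c) (hx : ∀ k, x (k + 1) = averaging (A k) (x k)) :
    ∃ v, ∀ i, Tendsto (fun k => x k i) atTop (𝓝 v) := by
  have hexact : IsPerturbedAveraging A (fun _ => 0) x := fun k => by simp [hx k]
  have hsum : Summable fun k => spread (x k) := by
    simpa using hexact.summable_mul_spread (γ := fun _ => 1) hA antitone_const (by simp)
      antitone_const (by simp)
  let j := Classical.arbitrary ι
  have hcauchy : CauchySeq fun k => x k j := by
    refine cauchySeq_of_summable_dist (hsum.of_nonneg_of_le (fun _ => dist_nonneg) fun k => ?_)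
    rw [dist_eq_norm, hx k]
    exact norm_sub_le_spread_of_mem_convexHull (subset_convexHull ℝ _ ⟨j, rfl⟩)
      (weightedMean_mem_convexHull (row_mem_stdSimplex (hA.mem_rowStochastic k) j) (x k))
  obtain ⟨v, hv⟩ := cauchySeq_tendsto_of_complete hcauchy
  refine ⟨v, fun i => ?_⟩
  have hconsensus : Tendsto (fun k => x k i - x k j) atTop (𝓝 0) :=
    squeeze_zero_norm (fun k => norm_sub_le_spread (x k) i j) hsum.tendsto_atTop_zero
  simpa using hconsensus.add hv

end Consensus

/-! ### Absolute probability sequences -/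

section AbsoluteProbability

variable {ι : Type*} [Fintype ι] {A : ℕ → Matrix ι ι ℝ} {c : ℝ} {φ : ℕ → ι → ℝ}

/-- An absolute probability sequence, in the sense of Kolmogorov, of a sequence of stochastic
matrices, with all its entries at least `c > 0`. -/
structure IsAbsoluteProbabilitySequence (A : ℕ → Matrix ι ι ℝ) (c : ℝ) (φ : ℕ → ι → ℝ) :
    Prop where
  pos : 0 < c
  le : ∀ s i, c ≤ φ s i
  mem_stdSimplex : ∀ s, φ s ∈ stdSimplex ℝ ι
  vecMul_eq : ∀ s, Matrix.vecMul (φ (s + 1)) (A s) = φ s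

theorem IsAbsoluteProbabilitySequence.entry_pos (hφ : IsAbsoluteProbabilitySequence A c φ) (s : ℕ)
    (i : ι) : 0 < φ s i := hφ.pos.trans_le (hφ.le s i)

theorem IsAbsoluteProbabilitySequence.weightedMean_averaging
    (hφ : IsAbsoluteProbabilitySequence A c φ) {E : Type*} [NormedAddCommGroup E]
    [NormedSpace ℝ E] (s : ℕ) (x : ι → E) :
    weightedMean (φ (s + 1)) (averaging (A s) x) = weightedMean (φ s) x := by
  rw [_root_.weightedMean_averaging, hφ.vecMul_eq]

variable [DecidableEq ι] [Nonempty ι] {B : ℕ}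

theorem IsUniformlyMixing.exists_tendsto_blockProd (hA : IsUniformlyMixing A B c) (s : ℕ) :
    ∃ v : ι → ℝ, ∀ i, Tendsto (fun m => blockProd A s m i) atTop (𝓝 v) := by
  have hcol : ∀ j, ∃ v : ℝ, ∀ i, Tendsto (fun m => blockProd A s m i j) atTop (𝓝 v) := fun j =>
    (hA.shift s).exists_tendsto_of_averaging (x := fun m i => blockProd A s m i j) fun m => by
      ext i
      simp [averaging, weightedMean, blockProd, Matrix.mul_apply]
  choose v hv using hcol
  exact ⟨v, fun i => tendsto_pi_nhds.2 fun j => hv j i⟩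

theorem IsUniformlyMixing.exists_isAbsoluteProbabilitySequence (hA : IsUniformlyMixing A B c) :
    ∃ φ : ℕ → ι → ℝ, IsAbsoluteProbabilitySequence A c φ ∧
      ∀ s i, Tendsto (fun m => blockProd A s m i) atTop (𝓝 (φ s)) := by
  choose φ hφ using hA.exists_tendsto_blockProd
  let i := Classical.arbitrary ι
  refine ⟨φ, ⟨hA.pos, fun s j => ?_, fun s => ?_, fun s => ?_⟩, hφ⟩
  · refine ge_of_tendsto (tendsto_pi_nhds.1 (hφ s i) j) (eventually_atTop.2 ⟨B, fun m hm => ?_⟩)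
    obtain ⟨l, rfl⟩ := Nat.exists_eq_add_of_le hm
    exact hA.le_blockProd_add s l i j
  · exact (isClosed_stdSimplex ℝ ι).mem_of_tendsto (hφ s i) (Eventually.of_forall fun m =>
      row_mem_stdSimplex (blockProd_mem hA.mem_rowStochastic s m) i)
  · have hstep : ∀ m, Matrix.vecMul (blockProd A (s + 1) m i) (A s) = blockProd A s (m + 1) i :=
      fun m => by rw [blockProd_succ', Matrix.mul_apply_eq_vecMul]
    have hcont : Continuous fun p : ι → ℝ => Matrix.vecMul p (A s) := by fun_prop
    refine tendsto_nhds_unique ((hcont.tendsto _).comp (hφ (s + 1) i)) ?_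
    simpa only [Function.comp_def, hstep] using (hφ s i).comp (tendsto_add_atTop_nat 1)

theorem IsAbsoluteProbabilitySequence.isLimitVector {n : ℕ} {A : ℕ → Matrix (Fin n) (Fin n) ℝ}
    {φ : ℕ → Fin n → ℝ} (hφ : IsAbsoluteProbabilitySequence A c φ) {s : ℕ}
    (hlim : ∀ i, Tendsto (fun m => blockProd A s m i) atTop (𝓝 (φ s))) :
    IsLimitVector A s (φ s) := by
  refine ⟨hφ.entry_pos s, (hφ.mem_stdSimplex s).2, ?_⟩
  rw [← tendsto_add_atTop_iff_nat s]
  simp only [transition_add]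
  refine tendsto_pi_nhds.2 fun i => ?_
  have hrow : Matrix.vecMulVec 1 (φ s) i = φ s := by ext j; simp [Matrix.vecMulVec_apply]
  simpa only [hrow, Function.comp_def] using (hlim i).comp (tendsto_add_atTop_nat 1)

theorem UJSC.exists_isLimitVector {n : ℕ} [Nonempty (Fin n)] {E : ℕ → Fin n → Fin n → Prop}
    (hE : UJSC E) {A : ℕ → Matrix (Fin n) (Fin n) ℝ}
    (hA : ∀ k, A k ∈ Matrix.rowStochastic ℝ (Fin n)) {η : ℝ} (hη : 0 < η)
    (hdiag : ∀ k i, η ≤ A k i i) (harc : ∀ k i j, E k j i → η ≤ A k i j) :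
    ∃ c φ, (∃ B, IsUniformlyMixing A B c) ∧ IsAbsoluteProbabilitySequence A c φ ∧
      ∀ s, IsLimitVector A s (φ s) := by
  obtain ⟨B, c, hmix⟩ := hE.exists_isUniformlyMixing hA hη hdiag harc
  obtain ⟨φ, hφ, hlim⟩ := hmix.exists_isAbsoluteProbabilitySequence
  exact ⟨c, φ, ⟨B, hmix⟩, hφ, fun s => hφ.isLimitVector (hlim s)⟩

end AbsoluteProbability
/-! ### Subgradients and projections -/

section Subgradients

variable {m : ℕ} {φ : RVec m → ℝ} {K : Set (RVec m)}

theorem convexSubdiff_nonempty (hφ : ConvexOn ℝ Set.univ φ) (z : RVec m) :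
    (convexSubdiff φ z).Nonempty := by
  have hopen : IsOpen {p : RVec m × ℝ | φ p.1 < p.2} :=
    isOpen_lt ((continuousOn_univ.1 (hφ.continuousOn isOpen_univ)).comp continuous_fst)
      continuous_snd
  obtain ⟨F, hF⟩ := geometric_hahn_banach_open_point (x := (z, φ z))
    (by simpa using hφ.convex_strict_epigraph) hopen (by simp)
  set t := F (0, 1)
  have F_apply (w : RVec m) (s : ℝ) : F (w, s) = F (w, 0) + s * t := by
    have : ((w, s) : RVec m × ℝ) = (w, 0) + s • (0, 1) := by simp
    rw [this, map_add, map_smul, smul_eq_mul]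
  have t_neg : t < 0 := by
    have := hF (z, φ z + 1) (by simp)
    rw [F_apply z (φ z + 1), F_apply z (φ z)] at this
    linarith
  have le_at_z (w : RVec m) : F (w, 0) + φ w * t ≤ F (z, 0) + φ z * t := by
    refine le_of_forall_pos_lt_add fun ε hε => ?_
    have := hF (w, φ w + ε / (-t)) (by simp [hε, t_neg])
    rw [F_apply w, F_apply z, add_mul, div_mul_eq_mul_div, mul_div_assoc, div_neg,
      div_self t_neg.ne] at this
    linarith
  set G : RVec m →L[ℝ] ℝ := (-t)⁻¹ • F.comp (ContinuousLinearMap.inl ℝ (RVec m) ℝ) with hG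
  refine ⟨(InnerProductSpace.toDual ℝ (RVec m)).symm G, fun w => ?_⟩
  have G_apply : G (w - z) = (-t)⁻¹ * (F (w, 0) - F (z, 0)) := by simp [hG, ← map_sub]
  rw [real_inner_comm, InnerProductSpace.toDual_symm_apply, G_apply, inv_mul_eq_div, ge_iff_le,
    ← le_sub_iff_add_le', div_le_iff₀ (by linarith)]
  linarith [le_at_z w]

theorem mem_concaveSubdiff_iff_neg {z q : RVec m} :
    q ∈ concaveSubdiff φ z ↔ -q ∈ convexSubdiff (fun w => -φ w) z := by
  simp only [concaveSubdiff, convexSubdiff, Set.mem_ofPred_eq, inner_neg_right]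
  refine forall_congr' fun w => ?_
  constructor <;> intro h <;> linarith

theorem sub_le_of_convexSubdiff_bounded (hφ : ConvexOn ℝ Set.univ φ) {L : ℝ} {x : RVec m}
    (hL : ∀ q ∈ convexSubdiff φ x, ‖q‖ ≤ L) (x' : RVec m) : φ x - φ x' ≤ L * ‖x - x'‖ := by
  obtain ⟨q, hq⟩ := convexSubdiff_nonempty hφ x
  have subgradient_ineq : φ x' ≥ φ x + inner ℝ (x' - x) q := hq x'
  rw [← neg_sub x x', inner_neg_left] at subgradient_ineq
  calc φ x - φ x' ≤ inner ℝ (x - x') q := by linarith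
    _ ≤ ‖x - x'‖ * ‖q‖ := real_inner_le_norm _ _
    _ ≤ ‖x - x'‖ * L := mul_le_mul_of_nonneg_left (hL q hq) (norm_nonneg _)
    _ = L * ‖x - x'‖ := mul_comm _ _

theorem exists_neg_mul_one_add_norm_sub_le (hφ : ConvexOn ℝ Set.univ φ) (x₀ : RVec m) :
    ∃ D ≥ 0, ∀ x, -(D * (1 + ‖x - x₀‖)) ≤ φ x := by
  obtain ⟨q, hq⟩ := convexSubdiff_nonempty hφ x₀
  refine ⟨|φ x₀| + ‖q‖, by positivity, fun x => ?_⟩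
  have subgradient_ineq : φ x₀ + inner ℝ (x - x₀) q ≤ φ x := hq x
  have inner_ge := neg_le_of_abs_le (abs_real_inner_le_norm (x - x₀) q)
  nlinarith [neg_abs_le (φ x₀), mul_nonneg (abs_nonneg (φ x₀)) (norm_nonneg (x - x₀)),
    norm_nonneg q]

theorem IsProjection.norm_sub_le {z p w : RVec m} (hp : IsProjection K z p) (hK : Convex ℝ K)
    (hw : w ∈ K) : ‖p - w‖ ≤ ‖z - w‖ := by
  have minimal : ‖z - p‖ = ⨅ v : K, ‖z - v‖ := by
    rw [hp.2, Metric.infDist_eq_iInf]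
    simp only [dist_eq_norm]
  have obtuse := (norm_eq_iInf_iff_real_inner_le_zero hK hp.1).1 minimal w hw
  have cosine_law : ‖z - w‖ ^ 2 = ‖z - p‖ ^ 2 - 2 * inner ℝ (z - p) (w - p) + ‖p - w‖ ^ 2 := by
    rw [norm_sub_rev p w, ← norm_sub_sq_real, sub_sub_sub_cancel_right]
  refine le_of_sq_le_sq ?_ (norm_nonneg _)
  nlinarith [sq_nonneg ‖z - p‖]

theorem IsProjection.norm_sub_sq_le_of_mem_convexSubdiff {w q p z : RVec m} {α : ℝ}
    (hp : IsProjection K (w - α • q) p) (hK : Convex ℝ K) (hq : q ∈ convexSubdiff φ w)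
    (hα : 0 ≤ α) (hz : z ∈ K) :
    ‖p - z‖ ^ 2 ≤ ‖w - z‖ ^ 2 - 2 * α * (φ w - φ z) + α ^ 2 * ‖q‖ ^ 2 := by
  have subgradient_ineq : φ z ≥ φ w + inner ℝ (z - w) q := hq z
  rw [← neg_sub w z, inner_neg_left] at subgradient_ineq
  calc ‖p - z‖ ^ 2 ≤ ‖w - α • q - z‖ ^ 2 := by gcongr; exact hp.norm_sub_le hK hz
    _ = ‖w - z‖ ^ 2 - 2 * α * inner ℝ (w - z) q + α ^ 2 * ‖q‖ ^ 2 := by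
        rw [sub_right_comm, norm_sub_sq_real, real_inner_smul_right, norm_smul, mul_pow,
          Real.norm_eq_abs, sq_abs]
        ring
    _ ≤ ‖w - z‖ ^ 2 - 2 * α * (φ w - φ z) + α ^ 2 * ‖q‖ ^ 2 := by
        nlinarith [mul_le_mul_of_nonneg_left subgradient_ineq hα]

end Subgradients

/-! ### Growth of convex-concave functions -/

theorem ConvexConcave.exists_forall_mem_neg_mul_le_of_isCompact {m₁ m₂ : ℕ}
    {f : RVec m₁ → RVec m₂ → ℝ} (hf : ConvexConcave f) (x₀ : RVec m₁) {K : Set (RVec m₂)}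
    (hK : IsCompact K) (hKconv : Convex ℝ K) :
    ∃ D ≥ 0, ∀ x, ∀ z ∈ K, -(D * (1 + ‖x - x₀‖)) ≤ f x z := by
  obtain ⟨t, htK, -⟩ := hKconv.exists_subset_interior_convexHull_finset_of_isCompact hK univ_mem
  choose D hD0 hD using fun z => exists_neg_mul_one_add_norm_sub_le (hf.1 z) x₀
  refine ⟨∑ z ∈ t, D z, Finset.sum_nonneg fun z _ => hD0 z, fun x z hz => ?_⟩
  have vertices : (t : Set (RVec m₂)) ⊆
      {y ∈ Set.univ | -((∑ z ∈ t, D z) * (1 + ‖x - x₀‖)) ≤ f x y} := by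
    intro y hy
    refine ⟨Set.mem_univ _, le_trans (neg_le_neg ?_) (hD y x)⟩
    gcongr
    exact Finset.single_le_sum (fun z _ => hD0 z) hy
  exact (convexHull_min vertices ((hf.2 x).convex_ge _) (interior_subset (htK hz))).2

theorem div_add_mul_two_add_norm_le {E : Type*} [SeminormedAddCommGroup E] {r : ℝ} (hr : 0 < r)
    (u v y₀ : E) :
    ‖u - v‖ / (‖u - v‖ + r) * (2 + ‖u - y₀‖ + ‖v - y₀‖) ≤
      (2 / r + 1) * (1 + ‖v - y₀‖) * ‖u - v‖ := by
  have triangle : ‖u - y₀‖ ≤ ‖u - v‖ + ‖v - y₀‖ := norm_sub_le_norm_sub_add_norm_sub u v y₀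
  have ha := norm_nonneg (v - y₀)
  have hδ := norm_nonneg (u - v)
  generalize ‖u - v‖ = δ at *
  generalize ‖v - y₀‖ = a at *
  calc δ / (δ + r) * (2 + ‖u - y₀‖ + a) ≤ δ / (δ + r) * (2 + 2 * a) + δ / (δ + r) * δ := by
        rw [← mul_add]
        exact mul_le_mul_of_nonneg_left (by linarith) (by positivity)
    _ ≤ δ / r * (2 + 2 * a) + 1 * δ := by
        gcongr
        · linarith
        · exact div_le_one_of_le₀ (by linarith) (by linarith)
    _ ≤ δ / r * (2 + 2 * a) + (1 + a) * δ := by gcongr; linarith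
    _ = (2 / r + 1) * (1 + a) * δ := by ring

section ConcaveGrowth

variable {E : Type*} [NormedAddCommGroup E] [NormedSpace ℝ E] {Y : Set E}

theorem exists_mem_closedBall_mix_eq {u v y₀ : E} {r θ : ℝ} (hr : 0 < r)
    (hθ : θ = ‖u - v‖ / (‖u - v‖ + r)) :
    ∃ z ∈ Metric.closedBall y₀ r, (1 - θ) • v + θ • y₀ = (1 - θ) • u + θ • z := by
  rcases eq_or_ne u v with rfl | huv
  · exact ⟨y₀, Metric.mem_closedBall_self hr.le, rfl⟩
  have hδ : 0 < ‖u - v‖ := norm_pos_iff.2 (sub_ne_zero.2 huv)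
  refine ⟨y₀ + (r / ‖u - v‖) • (v - u), ?_, ?_⟩
  · rw [mem_closedBall_iff_norm, add_sub_cancel_left, norm_smul, norm_sub_rev v,
      Real.norm_of_nonneg (by positivity), div_mul_cancel₀ _ hδ.ne']
  · have : θ * (r / ‖u - v‖) = 1 - θ := by rw [hθ]; field_simp; ring
    rw [smul_add, smul_smul, this]
    module

theorem mix_le_of_concaveOn_of_forall_mem_ball {h : E → ℝ} (hconc : ConcaveOn ℝ Set.univ h)
    {y₀ : E} {r a : ℝ} (hr : 0 < r) (hlow : ∀ z ∈ Metric.closedBall y₀ r, -a ≤ h z) {u v : E}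
    {θ : ℝ} (hθ : θ = ‖u - v‖ / (‖u - v‖ + r)) :
    (1 - θ) * h u - θ * a ≤ h ((1 - θ) • v + θ • y₀) := by
  have hθ0 : 0 ≤ θ := by rw [hθ]; positivity
  have hθ1 : θ ≤ 1 := by rw [hθ, div_le_one (by positivity)]; linarith
  obtain ⟨z, hz, mix_eq⟩ := exists_mem_closedBall_mix_eq (y₀ := y₀) hr hθ
  have := hconc.2 (Set.mem_univ u) (Set.mem_univ z) (sub_nonneg.2 hθ1) hθ0 (by ring)
  rw [← mix_eq, smul_eq_mul, smul_eq_mul] at this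
  linarith [mul_le_mul_of_nonneg_left (hlow z hz) hθ0]

theorem le_add_div_mul_of_concaveOn_of_forall_mem_ball {h : E → ℝ}
    (hconc : ConcaveOn ℝ Set.univ h) {y₀ : E} {r a : ℝ} (hr : 0 < r)
    (hlow : ∀ z ∈ Metric.closedBall y₀ r, -a ≤ h z) (y : E) :
    h y ≤ h y₀ + ‖y - y₀‖ / r * (h y₀ + a) := by
  have mix := mix_le_of_concaveOn_of_forall_mem_ball hconc hr hlow (u := y) (v := y₀) rfl
  rw [← add_smul, sub_add_cancel, one_smul] at mix
  have hpos : 0 < ‖y - y₀‖ + r := by positivity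
  field_simp at mix ⊢
  linarith

variable {ι : Type*} [Fintype ι] {h : ι → E → ℝ} {y₀ : E} {M L : ℝ}

theorem mix_sub_le_of_concaveOn_family (hconc : ∀ i, ConcaveOn ℝ Y (h i)) (hy₀ : y₀ ∈ Y)
    (hM : ∀ i, ∀ y ∈ Y, |h i y| ≤ M * (1 + ‖y - y₀‖)) (hL0 : 0 ≤ L)
    (hL : ∀ y ∈ Y, ∀ y' ∈ Y, ∑ i, h i y - ∑ i, h i y' ≤ L * ‖y - y'‖)
    {v : E} (hv : v ∈ Y) {θ : ℝ} (hθ0 : 0 ≤ θ) (hθ1 : θ ≤ 1) (i : ι) :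
    h i ((1 - θ) • v + θ • y₀) - h i v ≤ θ * (L + Fintype.card ι * M) * (2 + ‖v - y₀‖) := by
  set p := (1 - θ) • v + θ • y₀ with hp
  set H := M * (2 + ‖v - y₀‖) with hH
  have lower (j : ι) : 0 ≤ h j p - h j v + θ * H := by
    have concave := (hconc j).2 hv hy₀ (sub_nonneg.2 hθ1) hθ0 (by ring)
    rw [← hp, smul_eq_mul, smul_eq_mul] at concave
    have at_y₀ := neg_le_of_abs_le (hM j y₀ hy₀)
    rw [sub_self, norm_zero] at at_y₀
    have : -H ≤ h j y₀ - h j v := by linarith [le_of_abs_le (hM j v hv)]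
    linarith [mul_le_mul_of_nonneg_left this hθ0]
  have hM0 : 0 ≤ M := by simpa using (abs_nonneg _).trans (hM i y₀ hy₀)
  have hθH : 0 ≤ θ * H := by positivity
  have hpv : ‖p - v‖ = θ * ‖v - y₀‖ := by
    rw [show p - v = θ • (y₀ - v) by rw [hp]; module, norm_smul, Real.norm_of_nonneg hθ0,
      norm_sub_rev]
  have sum_le := hL p ((hconc i).1 hv hy₀ (sub_nonneg.2 hθ1) hθ0 (by ring)) v hv
  have single_le := Finset.single_le_sum (fun j _ => lower j) (Finset.mem_univ i)
  rw [Finset.sum_add_distrib, Finset.sum_sub_distrib, Finset.sum_const, Finset.card_univ,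
    nsmul_eq_mul] at single_le
  calc h i p - h i v ≤ L * (θ * ‖v - y₀‖) + Fintype.card ι * (θ * H) := by rw [← hpv]; linarith
    _ ≤ L * (θ * (2 + ‖v - y₀‖)) + Fintype.card ι * (θ * H) := by gcongr; linarith
    _ = θ * (L + Fintype.card ι * M) * (2 + ‖v - y₀‖) := by rw [hH]; ring

theorem sub_le_mul_norm_of_concaveOn_family (hY : Convex ℝ Y)
    (hconc : ∀ i, ConcaveOn ℝ Set.univ (h i)) (hy₀ : y₀ ∈ Y) {r : ℝ} (hr : 0 < r)
    (hlow : ∀ i, ∀ z ∈ Metric.closedBall y₀ r, -M ≤ h i z)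
    (hM : ∀ i, ∀ y ∈ Y, |h i y| ≤ M * (1 + ‖y - y₀‖)) (hL0 : 0 ≤ L)
    (hL : ∀ y ∈ Y, ∀ y' ∈ Y, ∑ i, h i y - ∑ i, h i y' ≤ L * ‖y - y'‖)
    {u v : E} (hu : u ∈ Y) (hv : v ∈ Y) (i : ι) :
    h i u - h i v ≤ ‖u - v‖ / (‖u - v‖ + r) *
      ((L + (Fintype.card ι + 1) * M) * (2 + ‖u - y₀‖ + ‖v - y₀‖)) := by
  set θ := ‖u - v‖ / (‖u - v‖ + r) with hθ
  have hθ0 : 0 ≤ θ := by positivity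
  have hθ1 : θ ≤ 1 := by rw [hθ, div_le_one (by positivity)]; linarith
  have hM0 : 0 ≤ M := by simpa using (abs_nonneg _).trans (hM i y₀ hy₀)
  have from_u := mix_le_of_concaveOn_of_forall_mem_ball (hconc i) hr (hlow i) hθ
  have to_v := mix_sub_le_of_concaveOn_family
    (fun i => (hconc i).subset (Set.subset_univ Y) hY) hy₀ hM hL0 hL hv hθ0 hθ1 i
  calc h i u - h i v
      ≤ θ * (h i u + M) + θ * (L + Fintype.card ι * M) * (2 + ‖v - y₀‖) := by linarith
    _ ≤ θ * (M * (2 + ‖u - y₀‖ + ‖v - y₀‖)) +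
        θ * (L + Fintype.card ι * M) * (2 + ‖u - y₀‖ + ‖v - y₀‖) := by
        gcongr
        · nlinarith [le_of_abs_le (hM i u hu), mul_nonneg hM0 (norm_nonneg (v - y₀))]
        · linarith [norm_nonneg (u - y₀)]
    _ = _ := by ring

theorem abs_sub_le_mul_norm_of_concaveOn_family (hY : Convex ℝ Y)
    (hconc : ∀ i, ConcaveOn ℝ Set.univ (h i)) (hy₀ : y₀ ∈ Y) {r : ℝ} (hr : 0 < r)
    (hlow : ∀ i, ∀ z ∈ Metric.closedBall y₀ r, -M ≤ h i z)
    (hM : ∀ i, ∀ y ∈ Y, |h i y| ≤ M * (1 + ‖y - y₀‖)) (hL0 : 0 ≤ L)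
    (hL : ∀ y ∈ Y, ∀ y' ∈ Y, ∑ i, h i y - ∑ i, h i y' ≤ L * ‖y - y'‖)
    {u v : E} (hu : u ∈ Y) (hv : v ∈ Y) (i : ι) :
    |h i u - h i v| ≤
      (L + (Fintype.card ι + 1) * M) * ((2 / r + 1) * (1 + ‖v - y₀‖) * ‖u - v‖) := by
  have hM0 : 0 ≤ M := by simpa using (abs_nonneg _).trans (hM i y₀ hy₀)
  have forward := sub_le_mul_norm_of_concaveOn_family hY hconc hy₀ hr hlow hM hL0 hL hu hv i
  have backward := sub_le_mul_norm_of_concaveOn_family hY hconc hy₀ hr hlow hM hL0 hL hv hu i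
  rw [norm_sub_rev v u, add_right_comm] at backward
  refine (abs_le.2 ⟨by linarith, forward⟩).trans ?_
  rw [mul_left_comm]
  exact mul_le_mul_of_nonneg_left (div_add_mul_two_add_norm_le hr u v y₀) (by positivity)

end ConcaveGrowth

section ConvexConcaveFamily

variable {m₁ m₂ : ℕ} {X : Set (RVec m₁)} {Y : Set (RVec m₂)} {x₀ : RVec m₁} {y₀ : RVec m₂} {L : ℝ}

theorem ConvexConcave.exists_le_bilinear {f : RVec m₁ → RVec m₂ → ℝ} (hf : ConvexConcave f)
    (hL0 : 0 ≤ L) (hL : ∀ x ∈ X, f x y₀ - f x₀ y₀ ≤ L * ‖x - x₀‖) :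
    ∃ C ≥ 0, (∀ x, ∀ z ∈ Metric.closedBall y₀ 1, -(C * (1 + ‖x - x₀‖)) ≤ f x z) ∧
      ∀ x ∈ X, ∀ y, f x y ≤ C * ((1 + ‖x - x₀‖) * (1 + ‖y - y₀‖)) := by
  obtain ⟨D, hD0, hlow⟩ := hf.exists_forall_mem_neg_mul_le_of_isCompact x₀
    (isCompact_closedBall y₀ 1) (convex_closedBall y₀ 1)
  set P := |f x₀ y₀| + L
  have hP0 : 0 ≤ P := by positivity
  have at_y₀ (x : RVec m₁) (hx : x ∈ X) : f x y₀ ≤ P * (1 + ‖x - x₀‖) := by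
    nlinarith [hL x hx, le_abs_self (f x₀ y₀),
      mul_nonneg (abs_nonneg (f x₀ y₀)) (norm_nonneg (x - x₀))]
  refine ⟨P + D, by positivity, fun x z hz => ?_, fun x hx y => ?_⟩
  · refine le_trans (neg_le_neg ?_) (hlow x z hz)
    gcongr
    linarith
  calc f x y ≤ f x y₀ + ‖y - y₀‖ / 1 * (f x y₀ + D * (1 + ‖x - x₀‖)) :=
        le_add_div_mul_of_concaveOn_of_forall_mem_ball (hf.2 x) one_pos (hlow x) y
    _ ≤ P * (1 + ‖x - x₀‖) + ‖y - y₀‖ / 1 * (P * (1 + ‖x - x₀‖) + D * (1 + ‖x - x₀‖)) := by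
        gcongr <;> exact at_y₀ x hx
    _ ≤ (P + D) * (1 + ‖x - x₀‖) + ‖y - y₀‖ / 1 * (P * (1 + ‖x - x₀‖) + D * (1 + ‖x - x₀‖)) := by
        gcongr
        linarith
    _ = (P + D) * ((1 + ‖x - x₀‖) * (1 + ‖y - y₀‖)) := by ring

variable {ι : Type*} [Fintype ι] {f : ι → RVec m₁ → RVec m₂ → ℝ} {L' : ℝ}

theorem neg_le_sum_of_lipschitz (hL0 : 0 ≤ L) (hL0' : 0 ≤ L')
    (hL : ∀ i, ∀ y ∈ Y, ∀ x ∈ X, ∀ x' ∈ X, f i x y - f i x' y ≤ L * ‖x - x'‖)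
    (hL' : ∀ x ∈ X, ∀ y ∈ Y, ∀ y' ∈ Y, ∑ i, f i x y - ∑ i, f i x y' ≤ L' * ‖y - y'‖)
    (hx₀ : x₀ ∈ X) (hy₀ : y₀ ∈ Y) {x : RVec m₁} (hx : x ∈ X) {y : RVec m₂} (hy : y ∈ Y) :
    -((∑ i, |f i x₀ y₀| + Fintype.card ι * L + L') * ((1 + ‖x - x₀‖) * (1 + ‖y - y₀‖))) ≤
      ∑ i, f i x y := by
  have vary_x : ∑ i, (-|f i x₀ y₀| - L * ‖x - x₀‖) ≤ ∑ i, f i x y₀ :=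
    Finset.sum_le_sum fun i _ => by
      rw [norm_sub_rev]
      linarith [hL i y₀ hy₀ x₀ hx₀ x hx, neg_abs_le (f i x₀ y₀)]
  rw [Finset.sum_sub_distrib, Finset.sum_neg_distrib, Finset.sum_const, Finset.card_univ,
    nsmul_eq_mul] at vary_x
  have vary_y := hL' x hx y₀ hy₀ y hy
  rw [norm_sub_rev] at vary_y
  have ha := norm_nonneg (x - x₀)
  have hb := norm_nonneg (y - y₀)
  have hab := mul_nonneg ha hb
  have one_le : 1 ≤ (1 + ‖x - x₀‖) * (1 + ‖y - y₀‖) := by linarith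
  have a_le : ‖x - x₀‖ ≤ (1 + ‖x - x₀‖) * (1 + ‖y - y₀‖) := by linarith
  have b_le : ‖y - y₀‖ ≤ (1 + ‖x - x₀‖) * (1 + ‖y - y₀‖) := by linarith
  have hR : 0 ≤ ∑ i, |f i x₀ y₀| := Finset.sum_nonneg fun i _ => abs_nonneg _
  linarith [mul_le_mul_of_nonneg_left one_le hR, mul_le_mul_of_nonneg_left b_le hL0',
    mul_le_mul_of_nonneg_left a_le (by positivity : 0 ≤ Fintype.card ι * L)]

theorem exists_abs_le_bilinear_of_convexConcave_family (hf : ∀ i, ConvexConcave (f i))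
    (hL0 : 0 ≤ L) (hL0' : 0 ≤ L')
    (hL : ∀ i, ∀ y ∈ Y, ∀ x ∈ X, ∀ x' ∈ X, f i x y - f i x' y ≤ L * ‖x - x'‖)
    (hL' : ∀ x ∈ X, ∀ y ∈ Y, ∀ y' ∈ Y, ∑ i, f i x y - ∑ i, f i x y' ≤ L' * ‖y - y'‖)
    (hx₀ : x₀ ∈ X) (hy₀ : y₀ ∈ Y) :
    ∃ M ≥ 0, (∀ i x, ∀ z ∈ Metric.closedBall y₀ 1, -(M * (1 + ‖x - x₀‖)) ≤ f i x z) ∧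
      ∀ i, ∀ x ∈ X, ∀ y ∈ Y, |f i x y| ≤ M * ((1 + ‖x - x₀‖) * (1 + ‖y - y₀‖)) := by
  choose c hc0 hball hup using fun i =>
    (hf i).exists_le_bilinear hL0 fun x hx => hL i y₀ hy₀ x hx x₀ hx₀
  set S := ∑ i, c i with hS
  have hcS (i : ι) : c i ≤ S := Finset.single_le_sum (fun j _ => hc0 j) (Finset.mem_univ i)
  have hS0 : 0 ≤ S := Finset.sum_nonneg fun i _ => hc0 i
  set R := ∑ i, |f i x₀ y₀| + Fintype.card ι * L + L'
  have hR0 : 0 ≤ R := by positivity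
  refine ⟨S + R, by positivity, fun i x z hz => le_trans (neg_le_neg ?_) (hball i x z hz),
    fun i x hx y hy => ?_⟩
  · gcongr
    linarith [hcS i]
  have sum_ge := neg_le_sum_of_lipschitz hL0 hL0' hL hL' hx₀ hy₀ hx hy
  set w := (1 + ‖x - x₀‖) * (1 + ‖y - y₀‖)
  have hw : 0 ≤ w := by positivity
  have single_le : c i * w - f i x y ≤ ∑ j, (c j * w - f j x y) :=
    Finset.single_le_sum (f := fun j => c j * w - f j x y)
      (fun j _ => sub_nonneg.2 (hup j x hx y)) (Finset.mem_univ i)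
  rw [Finset.sum_sub_distrib, ← Finset.sum_mul, ← hS] at single_le
  rw [add_mul, abs_le]
  constructor
  · linarith [mul_nonneg (hc0 i) hw]
  · linarith [hup i x hx y, mul_le_mul_of_nonneg_right (hcS i) hw, mul_nonneg hR0 hw]

theorem exists_abs_sub_le_of_convexConcave_family (hY : Convex ℝ Y)
    (hf : ∀ i, ConvexConcave (f i)) (hL0 : 0 ≤ L) (hL0' : 0 ≤ L')
    (hL : ∀ i, ∀ y ∈ Y, ∀ x ∈ X, ∀ x' ∈ X, f i x y - f i x' y ≤ L * ‖x - x'‖)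
    (hL' : ∀ x ∈ X, ∀ y ∈ Y, ∀ y' ∈ Y, ∑ i, f i x y - ∑ i, f i x y' ≤ L' * ‖y - y'‖)
    (hx₀ : x₀ ∈ X) (hy₀ : y₀ ∈ Y) :
    ∃ C ≥ 0, ∀ i, ∀ x ∈ X, ∀ u ∈ Y, ∀ v ∈ Y,
      |f i x u - f i x v| ≤ C * ((1 + ‖x - x₀‖) * (1 + ‖v - y₀‖)) * ‖u - v‖ := by
  obtain ⟨M, hM0, hlow, habs⟩ :=
    exists_abs_le_bilinear_of_convexConcave_family hf hL0 hL0' hL hL' hx₀ hy₀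
  refine ⟨3 * (L' + (Fintype.card ι + 1) * M), by positivity, fun i x hx u hu v hv => ?_⟩
  set a := ‖x - x₀‖
  have ha : 0 ≤ a := norm_nonneg _
  calc |f i x u - f i x v|
      ≤ (L' + (Fintype.card ι + 1) * (M * (1 + a))) *
          ((2 / 1 + 1) * (1 + ‖v - y₀‖) * ‖u - v‖) :=
        abs_sub_le_mul_norm_of_concaveOn_family (h := fun i => f i x) hY (fun i => (hf i).2 x) hy₀
          one_pos (fun i => hlow i x) (fun i y hy => by rw [mul_assoc]; exact habs i x hx y hy)
          hL0' (hL' x hx) hu hv i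
    _ ≤ (L' * (1 + a) + (Fintype.card ι + 1) * (M * (1 + a))) *
          ((2 / 1 + 1) * (1 + ‖v - y₀‖) * ‖u - v‖) := by
        gcongr
        exact le_mul_of_one_le_right hL0' (by linarith)
    _ = _ := by ring

end ConvexConcaveFamily

/-! ### Delayed averages -/

section DelayedAverage

variable {ι : Type*} {E : Type*} [NormedAddCommGroup E] [NormedSpace ℝ E]

/-- `z` is an average of the states that the agents had at some time `s ≥ 1` among the last `T`
times up to `k`. The initial time is excluded, because only the later states are feasible. -/
def IsRecentAverage (x : ℕ → ι → E) (T k : ℕ) (z : E) : Prop :=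
  ∃ s, 1 ≤ s ∧ s ≤ k ∧ k < s + T ∧ z ∈ convexHull ℝ (Set.range (x s))

theorem IsRecentAverage.mem {x : ℕ → ι → E} {T k : ℕ} {z : E} (hz : IsRecentAverage x T k z)
    {K : Set E} (hK : Convex ℝ K) (hx : ∀ s ≥ 1, ∀ i, x s i ∈ K) : z ∈ K := by
  obtain ⟨s, hs, -, -, hmem⟩ := hz
  exact convexHull_min (Set.range_subset_iff.2 (hx s hs)) hK hmem

variable [Fintype ι] {A : ℕ → Matrix ι ι ℝ} {c : ℝ} {φ : ℕ → ι → ℝ} {x : ℕ → ι → E} {δ : ℕ → ℝ}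

theorem IsPerturbedAveraging.norm_weightedMean_succ_sub_le (hx : IsPerturbedAveraging A δ x)
    (hφ : IsAbsoluteProbabilitySequence A c φ) (k : ℕ) :
    ‖weightedMean (φ (k + 1)) (x (k + 1)) - weightedMean (φ k) (x k)‖ ≤ δ k := by
  rw [← hφ.weightedMean_averaging k (x k), ← weightedMean_sub]
  exact (norm_weightedMean_le (hφ.mem_stdSimplex _) _).trans (hx k)

theorem IsPerturbedAveraging.norm_weightedMean_sub_le_sum (hx : IsPerturbedAveraging A δ x)
    (hφ : IsAbsoluteProbabilitySequence A c φ) {k t : ℕ} (ht : t ≤ k) :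
    ‖weightedMean (φ (k - t)) (x (k - t)) - weightedMean (φ k) (x k)‖ ≤
      ∑ l ∈ Finset.range t, δ (k - (l + 1)) := by
  rw [norm_sub_rev, ← dist_eq_norm]
  refine dist_le_range_sum_of_dist_le (f := fun l => weightedMean (φ (k - l)) (x (k - l))) t
    fun {l} hl => ?_
  have hstep := hx.norm_weightedMean_succ_sub_le hφ (k - (l + 1))
  rwa [show k - (l + 1) + 1 = k - l by lia, ← dist_eq_norm] at hstep

theorem IsPerturbedAveraging.norm_sub_weightedMean_le_of_isRecentAverage
    (hx : IsPerturbedAveraging A δ x) (hφ : IsAbsoluteProbabilitySequence A c φ) {T k : ℕ} {z : E}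
    (hz : IsRecentAverage x T k z) :
    ‖z - weightedMean (φ k) (x k)‖ ≤
      ∑ t ∈ Finset.range (T + 1), (spread (x (k - t)) + δ (k - t)) := by
  obtain ⟨s, -, hsk, hkT, hmem⟩ := hz
  obtain ⟨t, rfl⟩ := Nat.exists_eq_add_of_le hsk
  have to_past_mean : ‖z - weightedMean (φ s) (x s)‖ ≤
      ∑ l ∈ Finset.range (T + 1), spread (x (s + t - l)) := by
    refine (norm_sub_le_spread_of_mem_convexHull hmem
      (weightedMean_mem_convexHull (hφ.mem_stdSimplex s) (x s))).trans ?_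
    simpa using Finset.single_le_sum (f := fun l => spread (x (s + t - l)))
      (fun l _ => spread_nonneg _) (Finset.mem_range.2 (show t < T + 1 by lia))
  have drift : ‖weightedMean (φ s) (x s) - weightedMean (φ (s + t)) (x (s + t))‖ ≤
      ∑ l ∈ Finset.range (T + 1), δ (s + t - l) := by
    have hdrift := hx.norm_weightedMean_sub_le_sum hφ (Nat.le_add_left t s)
    rw [Nat.add_sub_cancel] at hdrift
    refine hdrift.trans ((le_add_of_nonneg_right (hx.nonneg (s + t - 0))).trans ?_)
    rw [← Finset.sum_range_succ' (fun l => δ (s + t - l))]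
    exact Finset.sum_le_sum_of_subset_of_nonneg (Finset.range_mono (by lia))
      fun l _ _ => hx.nonneg _
  rw [Finset.sum_add_distrib]
  exact (norm_sub_le_norm_sub_add_norm_sub _ _ _).trans (add_le_add to_past_mean drift)

theorem IsPerturbedAveraging.exists_summable_delay_bound [DecidableEq ι] [Nonempty ι] {B : ℕ}
    {γ : ℕ → ℝ} (hx : IsPerturbedAveraging A δ x) (hA : IsUniformlyMixing A B c)
    (hφ : IsAbsoluteProbabilitySequence A c φ) (hδ : Antitone δ) (hγ : ∀ k, 0 ≤ γ k)
    (hγanti : Antitone γ) (hsum : Summable fun k => γ k * δ k) (T : ℕ) :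
    ∃ e : ℕ → ℝ, (Summable fun k => γ k * e k) ∧ (∀ k, spread (x k) ≤ e k) ∧
      ∀ k z, IsRecentAverage x T k z → ‖z - weightedMean (φ k) (x k)‖ ≤ e k := by
  have hnonneg : ∀ k, 0 ≤ spread (x k) + δ k := fun k => add_nonneg (spread_nonneg _) (hx.nonneg k)
  refine ⟨fun k => ∑ t ∈ Finset.range (T + 1), (spread (x (k - t)) + δ (k - t)), ?_, fun k => ?_,
    fun k z => hx.norm_sub_weightedMean_le_of_isRecentAverage hφ⟩
  · simp only [Finset.mul_sum]
    have hspread : Summable fun k => γ k * (spread (x k) + δ k) := by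
      simpa only [mul_add] using (hx.summable_mul_spread hA hδ hγ hγanti hsum).add hsum
    exact summable_sum fun t _ =>
      summable_mul_comp_sub (w := fun k => spread (x k) + δ k) hγ hγanti hnonneg hspread t
  · have hcurrent := Finset.single_le_sum (f := fun t => spread (x (k - t)) + δ (k - t))
      (fun t _ => hnonneg _) (Finset.mem_range.2 T.succ_pos)
    exact (le_add_of_nonneg_right (hx.nonneg k)).trans hcurrent

end DelayedAverage

/-! ### Weighted squared distances -/

section MeanSqDist

variable {ι E : Type*} [Fintype ι] [NormedAddCommGroup E] {p : ι → ℝ}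

/-- The weighted mean squared distance of a family of points to a point: the Lyapunov function of
the iteration, when the weights form an absolute probability sequence. -/
noncomputable def meanSqDist (p : ι → ℝ) (x : ι → E) (z : E) : ℝ := ∑ i, p i * ‖x i - z‖ ^ 2

theorem meanSqDist_nonneg (hp : 0 ≤ p) (x : ι → E) (z : E) : 0 ≤ meanSqDist p x z :=
  Finset.sum_nonneg fun i _ => mul_nonneg (hp i) (sq_nonneg _)

theorem tendsto_of_tendsto_meanSqDist {p : ℕ → ι → ℝ} {c : ℝ} (hc : 0 < c)
    (hp : ∀ k i, c ≤ p k i) {x : ℕ → ι → E} {z : E}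
    (h : Tendsto (fun k => meanSqDist (p k) (x k) z) atTop (𝓝 0)) (i : ι) :
    Tendsto (fun k => x k i) atTop (𝓝 z) := by
  rw [tendsto_iff_norm_sub_tendsto_zero]
  have hsq : Tendsto (fun k => ‖x k i - z‖ ^ 2) atTop (𝓝 0) := by
    refine squeeze_zero (fun k => sq_nonneg _) (fun k => ?_) (by simpa using h.const_mul c⁻¹)
    rw [inv_mul_eq_div, le_div_iff₀ hc, mul_comm]
    exact (mul_le_mul_of_nonneg_right (hp k i) (sq_nonneg _)).trans <| Finset.single_le_sum
      (f := fun i => p k i * ‖x k i - z‖ ^ 2)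
      (fun i _ => mul_nonneg (hc.le.trans (hp k i)) (sq_nonneg _)) (Finset.mem_univ i)
  simpa using hsq.sqrt

variable [NormedSpace ℝ E]

theorem norm_weightedMean_sub_sq_le (hp : p ∈ stdSimplex ℝ ι) (x : ι → E) (z : E) :
    ‖weightedMean p x - z‖ ^ 2 ≤ meanSqDist p x z := by
  have hconv : ConvexOn ℝ Set.univ fun v : E => dist v z ^ 2 :=
    (convexOn_dist z convex_univ).pow (fun _ _ => dist_nonneg) 2
  simpa only [dist_eq_norm, smul_eq_mul, weightedMean, meanSqDist] using
    hconv.map_sum_le (fun i _ => hp.1 i) hp.2 fun i _ => Set.mem_univ (x i)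

theorem one_add_norm_mul_one_add_norm_le {κ F : Type*} [Fintype κ] [NormedAddCommGroup F]
    [NormedSpace ℝ F] (hp : p ∈ stdSimplex ℝ ι) {q : κ → ℝ} (hq : q ∈ stdSimplex ℝ κ)
    (x : ι → E) (y : κ → F) (z : E) (w : F) :
    (1 + ‖weightedMean p x - z‖) * (1 + ‖weightedMean q y - w‖) ≤
      2 * (1 + (meanSqDist p x z + meanSqDist q y w)) := by
  have hx := norm_weightedMean_sub_sq_le hp x z
  have hy := norm_weightedMean_sub_sq_le hq y w
  set a := ‖weightedMean p x - z‖
  set b := ‖weightedMean q y - w‖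
  nlinarith [sq_nonneg (a - b), sq_nonneg (a - 1), sq_nonneg (b - 1)]

theorem meanSqDist_le_spread_add_sq (hp : p ∈ stdSimplex ℝ ι) (x : ι → E) (z : E) :
    meanSqDist p x z ≤ (spread x + ‖weightedMean p x - z‖) ^ 2 := by
  have hdist : ∀ i, ‖x i - z‖ ≤ spread x + ‖weightedMean p x - z‖ := fun i =>
    (norm_sub_le_norm_sub_add_norm_sub _ (weightedMean p x) _).trans <| by
      gcongr
      exact norm_sub_le_spread_of_mem_convexHull (subset_convexHull ℝ _ ⟨i, rfl⟩)
        (weightedMean_mem_convexHull hp x)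
  calc meanSqDist p x z
    _ ≤ ∑ i, p i * (spread x + ‖weightedMean p x - z‖) ^ 2 :=
      Finset.sum_le_sum fun i _ =>
        mul_le_mul_of_nonneg_left (pow_le_pow_left₀ (norm_nonneg _) (hdist i) 2) (hp.1 i)
    _ = (spread x + ‖weightedMean p x - z‖) ^ 2 := by rw [← Finset.sum_mul, hp.2, one_mul]

theorem tendsto_meanSqDist_zero {α : Type*} {l : Filter α} {p : α → ι → ℝ}
    (hp : ∀ k, p k ∈ stdSimplex ℝ ι) {x : α → ι → E} {z : E}
    (hspread : Tendsto (fun k => spread (x k)) l (𝓝 0))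
    (hmean : Tendsto (fun k => weightedMean (p k) (x k)) l (𝓝 z)) :
    Tendsto (fun k => meanSqDist (p k) (x k) z) l (𝓝 0) :=
  squeeze_zero (fun k => meanSqDist_nonneg (hp k).1 _ _)
    (fun k => meanSqDist_le_spread_add_sq (hp k) _ _)
    (by simpa using (hspread.add (tendsto_iff_norm_sub_tendsto_zero.1 hmean)).pow 2)

theorem IsAbsoluteProbabilitySequence.meanSqDist_averaging_le [DecidableEq ι]
    {A : ℕ → Matrix ι ι ℝ} {c : ℝ} {φ : ℕ → ι → ℝ} (hφ : IsAbsoluteProbabilitySequence A c φ)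
    (hA : ∀ k, A k ∈ Matrix.rowStochastic ℝ ι) (k : ℕ) (x : ι → E) (z : E) :
    meanSqDist (φ (k + 1)) (averaging (A k) x) z ≤ meanSqDist (φ k) x z :=
  calc meanSqDist (φ (k + 1)) (averaging (A k) x) z
    _ ≤ weightedMean (φ (k + 1)) (averaging (A k) fun i => ‖x i - z‖ ^ 2) :=
      Finset.sum_le_sum fun i _ => mul_le_mul_of_nonneg_left
        (norm_weightedMean_sub_sq_le (row_mem_stdSimplex (hA k) i) x z) (hφ.entry_pos _ i).le
    _ = meanSqDist (φ k) x z := hφ.weightedMean_averaging k _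

end MeanSqDist

/-! ### The iteration of one subnetwork -/

/-- Positive non-increasing stepsizes satisfying the conditions `∑ γ = ∞` and `∑ γ² < ∞` of Robbins
and Monro. -/
structure IsRobbinsMonroStepsize (γ : ℕ → ℝ) : Prop where
  pos : ∀ k, 0 < γ k
  antitone : Antitone γ
  tendsto_sum : Tendsto (fun k => ∑ s ∈ Finset.range k, γ s) atTop atTop
  summable_sq : Summable fun k => γ k ^ 2

/-- One of the two players: its agents `i` hold convex-concave objectives `f i`, to be minimised in
the first variable over `X`, and run the projected subgradient iteration with weight matrices `A k`
and stepsizes `γ k / φ (k + 1) i`, where `u k i` is the information of agent `i` about the decision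
in `Y` of the opponent. A maximising player is encoded by `fun y x => -g j x y`. -/
structure IsSubnetworkRun {ι : Type*} [Fintype ι] [DecidableEq ι] {m₁ m₂ : ℕ} (X : Set (RVec m₁))
    (Y : Set (RVec m₂)) (f : ι → RVec m₁ → RVec m₂ → ℝ) (L : ℝ) (A : ℕ → Matrix ι ι ℝ) (c : ℝ)
    (φ : ℕ → ι → ℝ) (γ : ℕ → ℝ) (u : ℕ → ι → RVec m₂) (x : ℕ → ι → RVec m₁) : Prop where
  convex : Convex ℝ X
  convexConcave : ∀ i, ConvexConcave (f i)
  bound_nonneg : 0 ≤ L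
  norm_le : ∀ x ∈ X, ∀ y ∈ Y, ∀ i, ∀ q ∈ convexSubdiff (fun x' => f i x' y) x, ‖q‖ ≤ L
  exists_isUniformlyMixing : ∃ B, IsUniformlyMixing A B c
  isAbsoluteProbabilitySequence : IsAbsoluteProbabilitySequence A c φ
  step : ∀ k i, ∃ q ∈ convexSubdiff (fun x' => f i x' (u k i)) (averaging (A k) (x k) i),
    IsProjection X (averaging (A k) (x k) i - (γ k / φ (k + 1) i) • q) (x (k + 1) i)

namespace IsSubnetworkRun

variable {ι : Type*} [Fintype ι] [DecidableEq ι] {m₁ m₂ : ℕ} {X : Set (RVec m₁)}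
  {Y : Set (RVec m₂)} {f : ι → RVec m₁ → RVec m₂ → ℝ} {L : ℝ} {A : ℕ → Matrix ι ι ℝ} {c : ℝ}
  {φ : ℕ → ι → ℝ} {γ : ℕ → ℝ} {u : ℕ → ι → RVec m₂} {x : ℕ → ι → RVec m₁} {k : ℕ}

theorem mem_rowStochastic (hx : IsSubnetworkRun X Y f L A c φ γ u x) (k : ℕ) :
    A k ∈ Matrix.rowStochastic ℝ ι :=
  hx.exists_isUniformlyMixing.choose_spec.mem_rowStochastic k

theorem mem (hx : IsSubnetworkRun X Y f L A c φ γ u x) (k : ℕ) (hk : 1 ≤ k) (i : ι) :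
    x k i ∈ X := by
  obtain ⟨k, rfl⟩ := Nat.exists_eq_add_of_le' hk
  obtain ⟨q, -, hproj⟩ := hx.step k i
  exact hproj.1

theorem averaging_mem (hx : IsSubnetworkRun X Y f L A c φ γ u x) (hk : 1 ≤ k) (i : ι) :
    averaging (A k) (x k) i ∈ X :=
  weightedMean_mem (row_mem_stdSimplex (hx.mem_rowStochastic k) i) hx.convex (hx.mem k hk)

theorem mean_mem (hx : IsSubnetworkRun X Y f L A c φ γ u x) (hk : 1 ≤ k) :
    weightedMean (φ k) (x k) ∈ X :=
  weightedMean_mem (hx.isAbsoluteProbabilitySequence.mem_stdSimplex k) hx.convex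
    (hx.mem k hk)

theorem sub_le (hx : IsSubnetworkRun X Y f L A c φ γ u x) (i : ι) {y : RVec m₂} (hy : y ∈ Y)
    {w : RVec m₁} (hw : w ∈ X) (w' : RVec m₁) : f i w y - f i w' y ≤ L * ‖w - w'‖ :=
  sub_le_of_convexSubdiff_bounded ((hx.convexConcave i).1 y) (hx.norm_le w hw y hy i) w'

theorem sum_sub_sum_le (hx : IsSubnetworkRun X Y f L A c φ γ u x) {y : RVec m₂} (hy : y ∈ Y)
    {w : RVec m₁} (hw : w ∈ X) (w' : RVec m₁) :
    ∑ i, f i w y - ∑ i, f i w' y ≤ Fintype.card ι * L * ‖w - w'‖ := by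
  rw [← Finset.sum_sub_distrib]
  refine (Finset.sum_le_card_nsmul _ _ _ fun i _ => hx.sub_le i hy hw w').trans_eq ?_
  rw [nsmul_eq_mul, Finset.card_univ, mul_assoc]

theorem norm_succ_sub_averaging_le (hx : IsSubnetworkRun X Y f L A c φ γ u x) (hγ : 0 ≤ γ k)
    (hk : 1 ≤ k) (hu : ∀ i, u k i ∈ Y) :
    ‖x (k + 1) - averaging (A k) (x k)‖ ≤ L / c * γ k := by
  have hc := hx.isAbsoluteProbabilitySequence.pos
  have hL := hx.bound_nonneg
  refine (pi_norm_le_iff_of_nonneg (by positivity)).2 fun i => ?_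
  obtain ⟨q, hq, hproj⟩ := hx.step k i
  have hφ := hx.isAbsoluteProbabilitySequence.le (k + 1) i
  have hφpos := hx.isAbsoluteProbabilitySequence.entry_pos (k + 1) i
  have hqL := hx.norm_le _ (hx.averaging_mem hk i) _ (hu i) i q hq
  calc ‖x (k + 1) i - averaging (A k) (x k) i‖
    _ ≤ ‖averaging (A k) (x k) i - (γ k / φ (k + 1) i) • q - averaging (A k) (x k) i‖ :=
      hproj.norm_sub_le hx.convex (hx.averaging_mem hk i)
    _ = γ k / φ (k + 1) i * ‖q‖ := by
      rw [sub_sub_cancel_left, norm_neg, norm_smul, Real.norm_of_nonneg (by positivity)]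
    _ ≤ γ k / c * L := by gcongr
    _ = L / c * γ k := by ring

theorem exists_isPerturbedAveraging (hx : IsSubnetworkRun X Y f L A c φ γ u x)
    (hγ : ∀ k, 0 < γ k) (hu : ∀ᶠ k in atTop, ∀ i, u k i ∈ Y) :
    ∃ C ≥ 0, IsPerturbedAveraging A (fun k => C * γ k) x := by
  have hO : (fun k => x (k + 1) - averaging (A k) (x k)) =O[atTop] γ := by
    refine Asymptotics.IsBigO.of_bound (L / c) ?_
    filter_upwards [hu, eventually_ge_atTop 1] with k huk hk
    rw [Real.norm_of_nonneg (hγ k).le]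
    exact hx.norm_succ_sub_averaging_le (hγ k).le hk huk
  obtain ⟨C, hC, hbound⟩ := Asymptotics.bound_of_isBigO_nat_atTop hO
  refine ⟨C, hC.le, fun k => ?_⟩
  simpa only [Real.norm_of_nonneg (hγ k).le] using hbound (hγ k).ne'

theorem exists_summable_delay_bound [Nonempty ι] (hx : IsSubnetworkRun X Y f L A c φ γ u x)
    (hγ : IsRobbinsMonroStepsize γ) (hu : ∀ᶠ k in atTop, ∀ i, u k i ∈ Y) (T : ℕ) :
    ∃ e : ℕ → ℝ, (Summable fun k => γ k * e k) ∧ (∀ k, spread (x k) ≤ e k) ∧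
      ∀ k z, IsRecentAverage x T k z → ‖z - weightedMean (φ k) (x k)‖ ≤ e k := by
  obtain ⟨C, hC, hpert⟩ := hx.exists_isPerturbedAveraging hγ.pos hu
  obtain ⟨B, hA⟩ := hx.exists_isUniformlyMixing
  refine hpert.exists_summable_delay_bound hA hx.isAbsoluteProbabilitySequence
    (hγ.antitone.const_mul hC) (fun k => (hγ.pos k).le) hγ.antitone ?_ T
  exact (hγ.summable_sq.mul_left C).congr fun k => by ring

-- The factor `φ (k + 1) i` on the left cancels against the stepsize `γ k / φ (k + 1) i`.
theorem mul_norm_succ_sub_sq_le (hx : IsSubnetworkRun X Y f L A c φ γ u x) (hγ : 0 ≤ γ k)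
    (hk : 1 ≤ k) {i : ι} (hu : u k i ∈ Y) {z : RVec m₁} (hz : z ∈ X) :
    φ (k + 1) i * ‖x (k + 1) i - z‖ ^ 2 ≤
      φ (k + 1) i * ‖averaging (A k) (x k) i - z‖ ^ 2
        - 2 * γ k * (f i (averaging (A k) (x k) i) (u k i) - f i z (u k i))
        + L ^ 2 / c * γ k ^ 2 := by
  obtain ⟨q, hq, hproj⟩ := hx.step k i
  have hqL := hx.norm_le _ (hx.averaging_mem hk i) _ hu i q hq
  have hc := hx.isAbsoluteProbabilitySequence.pos
  have hφ := hx.isAbsoluteProbabilitySequence.le (k + 1) i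
  have hφpos := hx.isAbsoluteProbabilitySequence.entry_pos (k + 1) i
  set ψ := φ (k + 1) i
  set w := averaging (A k) (x k) i
  have hstep := hproj.norm_sub_sq_le_of_mem_convexSubdiff hx.convex hq (by positivity) hz
  calc ψ * ‖x (k + 1) i - z‖ ^ 2
    _ ≤ ψ * (‖w - z‖ ^ 2 - 2 * (γ k / ψ) * (f i w (u k i) - f i z (u k i))
        + (γ k / ψ) ^ 2 * ‖q‖ ^ 2) := by gcongr
    _ = ψ * ‖w - z‖ ^ 2 - 2 * γ k * (f i w (u k i) - f i z (u k i))
        + ‖q‖ ^ 2 / ψ * γ k ^ 2 := by field_simp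
    _ ≤ _ := by gcongr

theorem meanSqDist_succ_le (hx : IsSubnetworkRun X Y f L A c φ γ u x) (hγ : 0 ≤ γ k)
    (hk : 1 ≤ k) (hu : ∀ i, u k i ∈ Y) {z : RVec m₁} (hz : z ∈ X) :
    meanSqDist (φ (k + 1)) (x (k + 1)) z ≤ meanSqDist (φ k) (x k) z
      - 2 * γ k * ∑ i, (f i (averaging (A k) (x k) i) (u k i) - f i z (u k i))
      + Fintype.card ι * (L ^ 2 / c) * γ k ^ 2 := by
  have hsum := Finset.sum_le_sum fun i (_ : i ∈ Finset.univ) =>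
    hx.mul_norm_succ_sub_sq_le hγ hk (hu i) hz
  rw [Finset.sum_add_distrib, Finset.sum_sub_distrib, ← Finset.mul_sum, Finset.sum_const,
    Finset.card_univ, nsmul_eq_mul, ← mul_assoc (Fintype.card ι : ℝ)] at hsum
  refine hsum.trans ?_
  gcongr
  exact hx.isAbsoluteProbabilitySequence.meanSqDist_averaging_le hx.mem_rowStochastic k (x k) z

theorem objective_diff_ge (hx : IsSubnetworkRun X Y f L A c φ γ u x) (hk : 1 ≤ k) {C e : ℝ}
    (hC : 0 ≤ C) {xs : RVec m₁} {v ys : RVec m₂} {i : ι}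
    (hlip : ∀ w ∈ X, |f i w (u k i) - f i w v| ≤
      C * ((1 + ‖w - xs‖) * (1 + ‖v - ys‖)) * ‖u k i - v‖)
    (hxs : xs ∈ X) (hu : u k i ∈ Y) (huv : ‖u k i - v‖ ≤ e) (hspread : spread (x k) ≤ e) :
    f i (weightedMean (φ k) (x k)) v - f i xs v
        - (L + 2 * C) * e * ((1 + ‖weightedMean (φ k) (x k) - xs‖) * (1 + ‖v - ys‖)) ≤
      f i (averaging (A k) (x k) i) (u k i) - f i xs (u k i) := by
  have hL := hx.bound_nonneg
  have he : 0 ≤ e := (norm_nonneg _).trans huv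
  have hmean := hx.mean_mem hk
  have hdev : ‖weightedMean (φ k) (x k) - averaging (A k) (x k) i‖ ≤ e :=
    (norm_sub_le_spread_of_mem_convexHull
      (weightedMean_mem_convexHull (hx.isAbsoluteProbabilitySequence.mem_stdSimplex k) _)
      (weightedMean_mem_convexHull (row_mem_stdSimplex (hx.mem_rowStochastic k) i) _)).trans hspread
  have hown := hx.sub_le i hu hmean (averaging (A k) (x k) i)
  have hother := (abs_le.1 (hlip _ hmean)).1
  have hother' := (abs_le.1 (hlip xs hxs)).2
  set a := ‖weightedMean (φ k) (x k) - xs‖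
  set b := ‖v - ys‖
  have ha : 0 ≤ a := norm_nonneg _
  have hb : 0 ≤ b := norm_nonneg _
  have own_le : L * ‖weightedMean (φ k) (x k) - averaging (A k) (x k) i‖ ≤
      L * e * ((1 + a) * (1 + b)) :=
    (mul_le_mul_of_nonneg_left hdev hL).trans <| le_mul_of_one_le_right (by positivity)
      (one_le_mul_of_one_le_of_one_le (by linarith) (by linarith))
  have other_le : C * ((1 + a) * (1 + b)) * ‖u k i - v‖ ≤ C * ((1 + a) * (1 + b)) * e := by gcongr
  have other_le' : C * ((1 + ‖xs - xs‖) * (1 + b)) * ‖u k i - v‖ ≤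
      C * ((1 + a) * (1 + b)) * e := by
    gcongr
    simpa using ha
  linarith

theorem exists_descent (hx : IsSubnetworkRun X Y f L A c φ γ u x) (hγ : ∀ k, 0 < γ k)
    (hY : Convex ℝ Y) {L' : ℝ} (hL0' : 0 ≤ L')
    (hL' : ∀ w ∈ X, ∀ y ∈ Y, ∀ y' ∈ Y, ∑ i, f i w y - ∑ i, f i w y' ≤ L' * ‖y - y'‖)
    {v : ℕ → RVec m₂} {e : ℕ → ℝ} (hspread : ∀ k, spread (x k) ≤ e k)
    (hu : ∀ᶠ k in atTop, v k ∈ Y ∧ ∀ i, u k i ∈ Y ∧ ‖u k i - v k‖ ≤ e k)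
    {xs : RVec m₁} {ys : RVec m₂} (hxs : xs ∈ X) (hys : ys ∈ Y) :
    ∃ C ≥ 0, ∀ᶠ k in atTop,
      meanSqDist (φ (k + 1)) (x (k + 1)) xs ≤ meanSqDist (φ k) (x k) xs
        - 2 * γ k * (∑ i, f i (weightedMean (φ k) (x k)) (v k) - ∑ i, f i xs (v k))
        + C * (γ k * e k) * ((1 + ‖weightedMean (φ k) (x k) - xs‖) * (1 + ‖v k - ys‖))
        + C * γ k ^ 2 := by
  obtain ⟨K, hK0, hK⟩ := exists_abs_sub_le_of_convexConcave_family hY hx.convexConcave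
    hx.bound_nonneg hL0' (fun i y hy w hw w' _ => hx.sub_le i hy hw w') hL' hxs hys
  have hL := hx.bound_nonneg
  have hc := hx.isAbsoluteProbabilitySequence.pos
  set n : ℝ := (Fintype.card ι : ℝ)
  refine ⟨2 * n * (L + 2 * K) + n * (L ^ 2 / c), by positivity, ?_⟩
  filter_upwards [hu, eventually_ge_atTop 1] with k ⟨hvk, huk⟩ hk
  have hγk := hγ k
  have he : 0 ≤ e k := (spread_nonneg _).trans (hspread k)
  have hstep := hx.meanSqDist_succ_le hγk.le hk (fun i => (huk i).1) hxs
  have hgap := Finset.sum_le_sum fun i (_ : i ∈ Finset.univ) =>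
    hx.objective_diff_ge hk hK0 (fun w hw => hK i w hw _ (huk i).1 _ hvk) hxs (huk i).1 (huk i).2
      (hspread k)
  rw [Finset.sum_sub_distrib, Finset.sum_sub_distrib, Finset.sum_const, Finset.card_univ,
    nsmul_eq_mul] at hgap
  set W := (1 + ‖weightedMean (φ k) (x k) - xs‖) * (1 + ‖v k - ys‖)
  have hgap' := mul_le_mul_of_nonneg_left hgap (show 0 ≤ 2 * γ k by positivity)
  have extra_linear : 0 ≤ n * (L ^ 2 / c) * (γ k * e k) * W := by positivity
  have extra_quadratic : 0 ≤ 2 * n * (L + 2 * K) * γ k ^ 2 := by positivity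
  linarith

end IsSubnetworkRun

/-! ### Convergence of the coupled iterations -/

section SaddlePoint

theorem tendsto_of_tendsto_strictConvexOn_min {E α : Type*} [NormedAddCommGroup E]
    [NormedSpace ℝ E] [ProperSpace E] {X : Set E} (hX : IsClosed X) {F : E → ℝ}
    (hF : Continuous F) (hconv : StrictConvexOn ℝ X F) {xs : E} (hxs : xs ∈ X)
    (hmin : IsMinOn F X xs) {l : Filter α} {z : α → E} {R : ℝ}
    (hz : ∀ᶠ k in l, z k ∈ X ∧ ‖z k - xs‖ ≤ R)
    (hlim : Tendsto (fun k => F (z k)) l (𝓝 (F xs))) : Tendsto z l (𝓝 xs) := by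
  have hcompact : IsCompact (Metric.closedBall xs R ∩ X) :=
    (isCompact_closedBall xs R).inter_right hX
  refine hcompact.tendsto_nhds_of_unique_mapClusterPt ?_ fun a ha hcluster => ?_
  · filter_upwards [hz] with k hk
    exact ⟨mem_closedBall_iff_norm.2 hk.2, hk.1⟩
  · have hFa : F a = F xs := by
      have hne : (𝓝 (F a) ⊓ 𝓝 (F xs)).NeBot :=
        (hcluster.continuousAt_comp hF.continuousAt).neBot.mono (inf_le_inf_left _ hlim)
      exact eq_of_nhds_neBot hne
    exact hconv.eq_of_isMinOn (fun x hx => hFa.trans_le (hmin hx)) hmin ha.2 hxs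

variable {m₁ m₂ : ℕ} {X : Set (RVec m₁)} {Y : Set (RVec m₂)} {U : RVec m₁ → RVec m₂ → ℝ}
  {xs : RVec m₁} {ys : RVec m₂}

theorem ConvexConcave.continuous_left (hU : ConvexConcave U) (y : RVec m₂) :
    Continuous fun x => U x y :=
  continuousOn_univ.1 ((hU.1 y).continuousOn isOpen_univ)

theorem ConvexConcave.continuous_right (hU : ConvexConcave U) (x : RVec m₁) :
    Continuous (U x) :=
  continuousOn_univ.1 ((hU.2 x).continuousOn isOpen_univ)

theorem IsSaddlePoint.gap_nonneg (hs : IsSaddlePoint X Y U xs ys) {a : RVec m₁} {b : RVec m₂}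
    (ha : a ∈ X) (hb : b ∈ Y) : 0 ≤ U a ys - U xs b := by
  have hle := hs.2.2 a ha b hb
  linarith

theorem IsSaddlePoint.tendsto_of_tendsto_gap (hs : IsSaddlePoint X Y U xs ys) (hX : IsClosed X)
    (hY : IsClosed Y) (hU : StrictConvexConcaveOn X Y U) (hcontX : Continuous fun x => U x ys)
    (hcontY : Continuous (U xs)) {α : Type*} {l : Filter α} {a : α → RVec m₁} {b : α → RVec m₂}
    {R : ℝ} (ha : ∀ᶠ k in l, a k ∈ X ∧ ‖a k - xs‖ ≤ R) (hb : ∀ᶠ k in l, b k ∈ Y ∧ ‖b k - ys‖ ≤ R)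
    (hgap : Tendsto (fun k => U (a k) ys - U xs (b k)) l (𝓝 0)) :
    Tendsto a l (𝓝 xs) ∧ Tendsto b l (𝓝 ys) := by
  obtain ⟨hxs, hys, hsaddle⟩ := hs
  have upper : Tendsto (fun k => U xs ys + (U (a k) ys - U xs (b k))) l (𝓝 (U xs ys)) := by
    simpa using hgap.const_add (U xs ys)
  have lower : Tendsto (fun k => U xs ys - (U (a k) ys - U xs (b k))) l (𝓝 (U xs ys)) := by
    simpa using hgap.const_sub (U xs ys)
  constructor
  · refine tendsto_of_tendsto_strictConvexOn_min hX hcontX (hU.1 ys hys) hxs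
      (fun x hx => (hsaddle x hx ys hys).2) ha
      (tendsto_of_tendsto_of_tendsto_of_le_of_le' tendsto_const_nhds upper ?_ ?_) <;>
    filter_upwards [ha, hb] with k hak hbk
    · exact (hsaddle _ hak.1 ys hys).2
    · linarith [(hsaddle xs hxs _ hbk.1).1]
  · have hlim : Tendsto (fun k => U xs (b k)) l (𝓝 (U xs ys)) := by
      refine tendsto_of_tendsto_of_tendsto_of_le_of_le' lower tendsto_const_nhds ?_ ?_ <;>
      filter_upwards [ha, hb] with k hak hbk
      · linarith [(hsaddle _ hak.1 ys hys).2]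
      · exact (hsaddle xs hxs _ hbk.1).1
    exact tendsto_of_tendsto_strictConvexOn_min hY hcontY.neg (hU.2 xs hxs).neg hys
      (fun y hy => neg_le_neg (hsaddle xs hxs y hy).1) hb hlim.neg

end SaddlePoint

/-- The runs of the two players of a game whose total objectives add up to zero on `X × Y`, where
after an initial phase of length `T` each agent is informed of some average of the states of the
opponent from the last `T` steps. -/
structure IsCoupledRun {ι κ : Type*} [Fintype ι] [DecidableEq ι] [Fintype κ] [DecidableEq κ]
    {m₁ m₂ : ℕ} (X : Set (RVec m₁)) (Y : Set (RVec m₂)) (f : ι → RVec m₁ → RVec m₂ → ℝ)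
    (g : κ → RVec m₂ → RVec m₁ → ℝ) (L : ℝ) (A₁ : ℕ → Matrix ι ι ℝ) (A₂ : ℕ → Matrix κ κ ℝ)
    (c₁ c₂ : ℝ) (φ₁ : ℕ → ι → ℝ) (φ₂ : ℕ → κ → ℝ) (γ : ℕ → ℝ) (T : ℕ) (u : ℕ → ι → RVec m₂)
    (v : ℕ → κ → RVec m₁) (x : ℕ → ι → RVec m₁) (y : ℕ → κ → RVec m₂) : Prop where
  left : IsSubnetworkRun X Y f L A₁ c₁ φ₁ γ u x
  right : IsSubnetworkRun Y X g L A₂ c₂ φ₂ γ v y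
  zero_sum : ∀ x ∈ X, ∀ y ∈ Y, ∑ i, f i x y = -∑ j, g j y x
  left_informed : ∀ k, T ≤ k → ∀ i, IsRecentAverage y T k (u k i)
  right_informed : ∀ k, T ≤ k → ∀ j, IsRecentAverage x T k (v k j)

namespace IsCoupledRun

variable {ι κ : Type*} [Fintype ι] [DecidableEq ι] [Fintype κ] [DecidableEq κ] {m₁ m₂ : ℕ}
  {X : Set (RVec m₁)} {Y : Set (RVec m₂)} {f : ι → RVec m₁ → RVec m₂ → ℝ}
  {g : κ → RVec m₂ → RVec m₁ → ℝ} {L : ℝ} {A₁ : ℕ → Matrix ι ι ℝ} {A₂ : ℕ → Matrix κ κ ℝ}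
  {c₁ c₂ : ℝ} {φ₁ : ℕ → ι → ℝ} {φ₂ : ℕ → κ → ℝ} {γ : ℕ → ℝ} {T : ℕ} {u : ℕ → ι → RVec m₂}
  {v : ℕ → κ → RVec m₁} {x : ℕ → ι → RVec m₁} {y : ℕ → κ → RVec m₂}

theorem symm (h : IsCoupledRun X Y f g L A₁ A₂ c₁ c₂ φ₁ φ₂ γ T u v x y) :
    IsCoupledRun Y X g f L A₂ A₁ c₂ c₁ φ₂ φ₁ γ T v u y x where
  left := h.right
  right := h.left
  zero_sum y hy x hx := by rw [h.zero_sum x hx y hy, neg_neg]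
  left_informed := h.right_informed
  right_informed := h.left_informed

theorem information_mem (h : IsCoupledRun X Y f g L A₁ A₂ c₁ c₂ φ₁ φ₂ γ T u v x y) {k : ℕ}
    (hk : T ≤ k) (i : ι) : u k i ∈ Y :=
  (h.left_informed k hk i).mem h.right.convex h.right.mem

theorem sum_sub_sum_le_opponent (h : IsCoupledRun X Y f g L A₁ A₂ c₁ c₂ φ₁ φ₂ γ T u v x y)
    {w : RVec m₁} (hw : w ∈ X) {z z' : RVec m₂} (hz : z ∈ Y) (hz' : z' ∈ Y) :
    ∑ i, f i w z - ∑ i, f i w z' ≤ Fintype.card κ * L * ‖z - z'‖ := by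
  rw [h.zero_sum w hw z hz, h.zero_sum w hw z' hz', norm_sub_rev, neg_sub_neg]
  exact h.right.sum_sub_sum_le hw hz' z

theorem exists_summable_error [Nonempty ι] [Nonempty κ]
    (h : IsCoupledRun X Y f g L A₁ A₂ c₁ c₂ φ₁ φ₂ γ T u v x y) (hγ : IsRobbinsMonroStepsize γ) :
    ∃ e : ℕ → ℝ, (Summable fun k => γ k * e k) ∧
      (∀ k, spread (x k) ≤ e k) ∧ (∀ k, spread (y k) ≤ e k) ∧
      (∀ k, T ≤ k → ∀ i, ‖u k i - weightedMean (φ₂ k) (y k)‖ ≤ e k) ∧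
      ∀ k, T ≤ k → ∀ j, ‖v k j - weightedMean (φ₁ k) (x k)‖ ≤ e k := by
  obtain ⟨e₁, hsum₁, hspread₁, hdelay₁⟩ := h.left.exists_summable_delay_bound hγ
    (eventually_atTop.2 ⟨T, fun _ => h.information_mem⟩) T
  obtain ⟨e₂, hsum₂, hspread₂, hdelay₂⟩ := h.right.exists_summable_delay_bound hγ
    (eventually_atTop.2 ⟨T, fun _ => h.symm.information_mem⟩) T
  have he₁ : ∀ k, 0 ≤ e₁ k := fun k => (spread_nonneg _).trans (hspread₁ k)
  have he₂ : ∀ k, 0 ≤ e₂ k := fun k => (spread_nonneg _).trans (hspread₂ k)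
  refine ⟨fun k => e₁ k + e₂ k, (hsum₁.add hsum₂).congr fun k => (mul_add _ _ _).symm,
    fun k => ?_, fun k => ?_, fun k hk i => ?_, fun k hk j => ?_⟩
  · exact (hspread₁ k).trans (le_add_of_nonneg_right (he₂ k))
  · exact (hspread₂ k).trans (le_add_of_nonneg_left (he₁ k))
  · exact (hdelay₂ k _ (h.left_informed k hk i)).trans (le_add_of_nonneg_left (he₁ k))
  · exact (hdelay₁ k _ (h.right_informed k hk j)).trans (le_add_of_nonneg_right (he₂ k))

theorem exists_descent_left (h : IsCoupledRun X Y f g L A₁ A₂ c₁ c₂ φ₁ φ₂ γ T u v x y)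
    (hγ : ∀ k, 0 < γ k) {e : ℕ → ℝ} (hspread : ∀ k, spread (x k) ≤ e k)
    (hdelay : ∀ k, T ≤ k → ∀ i, ‖u k i - weightedMean (φ₂ k) (y k)‖ ≤ e k)
    {xs : RVec m₁} {ys : RVec m₂} (hxs : xs ∈ X) (hys : ys ∈ Y) :
    ∃ C ≥ 0, ∀ᶠ k in atTop,
      meanSqDist (φ₁ (k + 1)) (x (k + 1)) xs ≤ meanSqDist (φ₁ k) (x k) xs
        - 2 * γ k * (∑ i, f i (weightedMean (φ₁ k) (x k)) (weightedMean (φ₂ k) (y k))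
          - ∑ i, f i xs (weightedMean (φ₂ k) (y k)))
        + C * (γ k * e k) * ((1 + ‖weightedMean (φ₁ k) (x k) - xs‖)
          * (1 + ‖weightedMean (φ₂ k) (y k) - ys‖))
        + C * γ k ^ 2 := by
  have hL := h.right.bound_nonneg
  refine h.left.exists_descent hγ h.right.convex (L' := Fintype.card κ * L) (by positivity)
    (fun w hw z hz z' hz' => h.sum_sub_sum_le_opponent hw hz hz') hspread ?_ hxs hys
  filter_upwards [eventually_ge_atTop T, eventually_ge_atTop 1] with k hkT hk
  exact ⟨h.right.mean_mem hk, fun i => ⟨h.information_mem hkT i, hdelay k hkT i⟩⟩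

-- The values `U(x̄, ȳ)` at the two means cancel when the descent inequalities are added.
theorem exists_descent (h : IsCoupledRun X Y f g L A₁ A₂ c₁ c₂ φ₁ φ₂ γ T u v x y)
    (hγ : ∀ k, 0 < γ k) {e : ℕ → ℝ} (hspreadx : ∀ k, spread (x k) ≤ e k)
    (hspready : ∀ k, spread (y k) ≤ e k)
    (hdelayx : ∀ k, T ≤ k → ∀ i, ‖u k i - weightedMean (φ₂ k) (y k)‖ ≤ e k)
    (hdelayy : ∀ k, T ≤ k → ∀ j, ‖v k j - weightedMean (φ₁ k) (x k)‖ ≤ e k)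
    {xs : RVec m₁} {ys : RVec m₂} (hxs : xs ∈ X) (hys : ys ∈ Y) :
    ∃ C ≥ 0, ∀ᶠ k in atTop,
      meanSqDist (φ₁ (k + 1)) (x (k + 1)) xs + meanSqDist (φ₂ (k + 1)) (y (k + 1)) ys ≤
        meanSqDist (φ₁ k) (x k) xs + meanSqDist (φ₂ k) (y k) ys
        - 2 * γ k * (∑ i, f i (weightedMean (φ₁ k) (x k)) ys
          - ∑ i, f i xs (weightedMean (φ₂ k) (y k)))
        + C * (γ k * e k) * (1 + (meanSqDist (φ₁ k) (x k) xs + meanSqDist (φ₂ k) (y k) ys))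
        + C * γ k ^ 2 := by
  obtain ⟨C₁, hC₁, hdesc₁⟩ := h.exists_descent_left hγ hspreadx hdelayx hxs hys
  obtain ⟨C₂, hC₂, hdesc₂⟩ := h.symm.exists_descent_left hγ hspready hdelayy hys hxs
  refine ⟨2 * (C₁ + C₂), by positivity, ?_⟩
  filter_upwards [hdesc₁, hdesc₂, eventually_ge_atTop 1] with k hk₁ hk₂ hk
  have hweight : (1 + ‖weightedMean (φ₁ k) (x k) - xs‖) * (1 + ‖weightedMean (φ₂ k) (y k) - ys‖) ≤
      2 * (1 + (meanSqDist (φ₁ k) (x k) xs + meanSqDist (φ₂ k) (y k) ys)) :=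
    one_add_norm_mul_one_add_norm_le (h.left.isAbsoluteProbabilitySequence.mem_stdSimplex k)
      (h.right.isAbsoluteProbabilitySequence.mem_stdSimplex k) _ _ _ _
  rw [h.symm.zero_sum _ (h.right.mean_mem hk) _ (h.left.mean_mem hk),
    h.symm.zero_sum _ hys _ (h.left.mean_mem hk), mul_comm (1 + ‖_ - ys‖)] at hk₂
  have he : 0 ≤ e k := (spread_nonneg _).trans (hspreadx k)
  have hγk := hγ k
  have herror : (C₁ + C₂) * (γ k * e k) * ((1 + ‖weightedMean (φ₁ k) (x k) - xs‖)
        * (1 + ‖weightedMean (φ₂ k) (y k) - ys‖)) ≤ (C₁ + C₂) * (γ k * e k)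
        * (2 * (1 + (meanSqDist (φ₁ k) (x k) xs + meanSqDist (φ₂ k) (y k) ys))) := by gcongr
  have hsq : 0 ≤ (C₁ + C₂) * γ k ^ 2 := by positivity
  linarith

theorem tendsto_mean_of_tendsto_gap (h : IsCoupledRun X Y f g L A₁ A₂ c₁ c₂ φ₁ φ₂ γ T u v x y)
    (hX : IsClosed X) (hY : IsClosed Y)
    (hU : StrictConvexConcaveOn X Y fun x y => ∑ i, f i x y) {xs : RVec m₁} {ys : RVec m₂}
    (hs : IsSaddlePoint X Y (fun x y => ∑ i, f i x y) xs ys) {ψ : ℕ → ℕ}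
    (hψ : Tendsto ψ atTop atTop) {R : ℝ}
    (hR : ∀ k, meanSqDist (φ₁ k) (x k) xs + meanSqDist (φ₂ k) (y k) ys ≤ R)
    (hgap : Tendsto (fun k => ∑ i, f i (weightedMean (φ₁ (ψ k)) (x (ψ k))) ys
      - ∑ i, f i xs (weightedMean (φ₂ (ψ k)) (y (ψ k)))) atTop (𝓝 0)) :
    Tendsto (fun k => weightedMean (φ₁ (ψ k)) (x (ψ k))) atTop (𝓝 xs) ∧
      Tendsto (fun k => weightedMean (φ₂ (ψ k)) (y (ψ k))) atTop (𝓝 ys) := by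
  have hφ₁ := h.left.isAbsoluteProbabilitySequence.mem_stdSimplex
  have hφ₂ := h.right.isAbsoluteProbabilitySequence.mem_stdSimplex
  have hψ₁ : ∀ᶠ k in atTop, 1 ≤ ψ k := hψ.eventually_ge_atTop 1
  have hf := h.left.convexConcave
  refine hs.tendsto_of_tendsto_gap (R := √R) hX hY hU
    (continuous_finsetSum _ fun i _ => (hf i).continuous_left ys)
    (continuous_finsetSum _ fun i _ => (hf i).continuous_right xs) ?_ ?_ hgap
  · filter_upwards [hψ₁] with k hk
    refine ⟨h.left.mean_mem hk, Real.le_sqrt_of_sq_le ?_⟩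
    linarith [hR (ψ k), norm_weightedMean_sub_sq_le (hφ₁ (ψ k)) (x (ψ k)) xs,
      meanSqDist_nonneg (hφ₂ (ψ k)).1 (y (ψ k)) ys]
  · filter_upwards [hψ₁] with k hk
    refine ⟨h.right.mean_mem hk, Real.le_sqrt_of_sq_le ?_⟩
    linarith [hR (ψ k), norm_weightedMean_sub_sq_le (hφ₂ (ψ k)) (y (ψ k)) ys,
      meanSqDist_nonneg (hφ₁ (ψ k)).1 (x (ψ k)) xs]

-- Along a subsequence the gap and the disagreement vanish, hence so does the Lyapunov function;
-- since it converges, its limit is zero.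
theorem tendsto_saddlePoint [Nonempty ι] [Nonempty κ]
    (h : IsCoupledRun X Y f g L A₁ A₂ c₁ c₂ φ₁ φ₂ γ T u v x y) (hγ : IsRobbinsMonroStepsize γ)
    (hX : IsClosed X) (hY : IsClosed Y)
    (hU : StrictConvexConcaveOn X Y fun x y => ∑ i, f i x y) {xs : RVec m₁} {ys : RVec m₂}
    (hs : IsSaddlePoint X Y (fun x y => ∑ i, f i x y) xs ys) :
    (∀ i, Tendsto (fun k => x k i) atTop (𝓝 xs)) ∧
      ∀ j, Tendsto (fun k => y k j) atTop (𝓝 ys) := by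
  obtain ⟨e, hsum, hspreadx, hspready, hdelayx, hdelayy⟩ := h.exists_summable_error hγ
  obtain ⟨C, hC, hdesc⟩ :=
    h.exists_descent hγ.pos hspreadx hspready hdelayx hdelayy hs.1 hs.2.1
  have hφ₁ := h.left.isAbsoluteProbabilitySequence
  have hφ₂ := h.right.isAbsoluteProbabilitySequence
  have hVx : ∀ k, 0 ≤ meanSqDist (φ₁ k) (x k) xs := fun k =>
    meanSqDist_nonneg (hφ₁.mem_stdSimplex k).1 _ _
  have hVy : ∀ k, 0 ≤ meanSqDist (φ₂ k) (y k) ys := fun k =>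
    meanSqDist_nonneg (hφ₂.mem_stdSimplex k).1 _ _
  have hgap : ∀ᶠ k in atTop, 0 ≤ ∑ i, f i (weightedMean (φ₁ k) (x k)) ys
      - ∑ i, f i xs (weightedMean (φ₂ k) (y k)) := by
    filter_upwards [eventually_ge_atTop 1] with k hk
    exact hs.gap_nonneg (h.left.mean_mem hk) (h.right.mean_mem hk)
  obtain ⟨⟨l, hl⟩, ψ, hψ, hgapψ, heψ⟩ := tendsto_and_exists_subseq_of_descent
    (fun k => add_nonneg (hVx k) (hVy k)) hγ.pos hC
    (fun k => (spread_nonneg _).trans (hspreadx k)) hγ.tendsto_sum hγ.summable_sq hsum hgap hdesc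
  obtain ⟨R, hR⟩ := hl.bddAbove_range
  have hbdd : ∀ k, meanSqDist (φ₁ k) (x k) xs + meanSqDist (φ₂ k) (y k) ys ≤ R := fun k =>
    hR ⟨k, rfl⟩
  obtain ⟨hmeanx, hmeany⟩ := h.tendsto_mean_of_tendsto_gap hX hY hU hs hψ.tendsto_atTop hbdd hgapψ
  have hVψ : Tendsto (fun k => meanSqDist (φ₁ (ψ k)) (x (ψ k)) xs +
      meanSqDist (φ₂ (ψ k)) (y (ψ k)) ys) atTop (𝓝 0) := by
    simpa using
      (tendsto_meanSqDist_zero (fun k => hφ₁.mem_stdSimplex (ψ k))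
        (squeeze_zero (fun k => spread_nonneg _) (fun k => hspreadx _) heψ) hmeanx).add
      (tendsto_meanSqDist_zero (fun k => hφ₂.mem_stdSimplex (ψ k))
        (squeeze_zero (fun k => spread_nonneg _) (fun k => hspready _) heψ) hmeany)
  obtain rfl : l = 0 := tendsto_nhds_unique (hl.comp hψ.tendsto_atTop) hVψ
  exact ⟨tendsto_of_tendsto_meanSqDist hφ₁.pos hφ₁.le <|
      squeeze_zero hVx (fun k => le_add_of_nonneg_right (hVy k)) hl,
    tendsto_of_tendsto_meanSqDist hφ₂.pos hφ₂.le <|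
      squeeze_zero hVy (fun k => le_add_of_nonneg_left (hVx k)) hl⟩

end IsCoupledRun

/-! ### The network -/

section Information

theorem exists_recent_isGreatest {P : ℕ → Prop} {T k : ℕ} (hk : T ≤ k)
    (hP : ∀ k, ∃ s, k ≤ s ∧ s < k + T ∧ P s) :
    ∃ s, 1 ≤ s ∧ k < s + T ∧ IsGreatest {t | t ≤ k ∧ P t} s := by
  obtain ⟨s₀, hle, hlt, hs₀⟩ := hP (k + 1 - T)
  have hmem : s₀ ∈ {t | t ≤ k ∧ P t} := ⟨by lia, hs₀⟩
  have hbdd : BddAbove {t | t ≤ k ∧ P t} := ⟨k, fun t ht => ht.1⟩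
  have hsup : s₀ ≤ sSup {t | t ≤ k ∧ P t} := le_csSup hbdd hmem
  exact ⟨_, by lia, by lia, Nat.sSup_mem ⟨s₀, hmem⟩ hbdd, fun t ht => le_csSup hbdd ht⟩

theorem isRecentAverage_of_isGreatest {ι E : Type*} [Fintype ι] [NormedAddCommGroup E]
    [NormedSpace ℝ E] {contact : ℕ → Prop} {p : ℕ → ι → ℝ}
    (hp : ∀ t, contact t → p t ∈ stdSimplex ℝ ι) {T : ℕ}
    (hcontact : ∀ k, ∃ s, k ≤ s ∧ s < k + T ∧ contact s) {x : ℕ → ι → E} {k : ℕ} {z : E}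
    (hz : ∀ s, IsGreatest {t | t ≤ k ∧ contact t} s → z = ∑ j, p s j • x s j) (hk : T ≤ k) :
    IsRecentAverage x T k z := by
  obtain ⟨s, hs₁, hks, hs⟩ := exists_recent_isGreatest hk hcontact
  refine ⟨s, hs₁, hs.1.1, hks, ?_⟩
  rw [hz s hs]
  exact weightedMean_mem_convexHull (hp s hs.1.2) (x s)

end Information

namespace CommNetwork

variable {n₁ n₂ : ℕ} {N : CommNetwork n₁ n₂}

theorem Connectivity.exists_contact (hN : N.Connectivity) :
    ∃ T, (∀ i k, ∃ s, k ≤ s ∧ s < k + T ∧ N.Contact₁ s i) ∧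
      ∀ j k, ∃ s, k ≤ s ∧ s < k + T ∧ N.Contact₂ s j := by
  obtain ⟨⟨T, -, hT⟩, -⟩ := hN
  refine ⟨T, fun i k => ?_, fun j k => ?_⟩
  · obtain ⟨j, s, hks, hsk, -, harc⟩ := (hT k).2.1 i
    exact ⟨s, hks, hsk, j, harc⟩
  · obtain ⟨i, s, hks, hsk, -, harc⟩ := (hT k).2.2 j
    exact ⟨s, hks, hsk, i, harc⟩

theorem WeightRule.exists_isLimitVector₁ [Nonempty (Fin n₁)] (hN : N.WeightRule)
    (hconn : UJSC N.Arc₁) :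
    ∃ c φ, (∃ B, IsUniformlyMixing N.A₁ B c) ∧ IsAbsoluteProbabilitySequence N.A₁ c φ ∧
      ∀ s, IsLimitVector N.A₁ s (φ s) := by
  obtain ⟨⟨η, hη, -, hweight⟩, ⟨hrow, -⟩, -⟩ := hN
  exact hconn.exists_isLimitVector
    (fun k => Matrix.mem_rowStochastic_iff_sum.2 ⟨fun _ _ => N.weight_nonneg k _ _, hrow k⟩) hη
    (fun k i => hweight k _ _ (N.self_loop k (Sum.inl i))) fun k i j => hweight k _ _

theorem WeightRule.exists_isLimitVector₂ [Nonempty (Fin n₂)] (hN : N.WeightRule)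
    (hconn : UJSC N.Arc₂) :
    ∃ c φ, (∃ B, IsUniformlyMixing N.A₂ B c) ∧ IsAbsoluteProbabilitySequence N.A₂ c φ ∧
      ∀ s, IsLimitVector N.A₂ s (φ s) := by
  obtain ⟨⟨η, hη, -, hweight⟩, ⟨-, hrow⟩, -⟩ := hN
  exact hconn.exists_isLimitVector
    (fun k => Matrix.mem_rowStochastic_iff_sum.2 ⟨fun _ _ => N.weight_nonneg k _ _, hrow k⟩) hη
    (fun k i => hweight k _ _ (N.self_loop k (Sum.inr i))) fun k i j => hweight k _ _

end CommNetwork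

section Game

variable {n₁ n₂ m₁ m₂ : ℕ} {X : Set (RVec m₁)} {Y : Set (RVec m₂)}
  {f : Fin n₁ → RVec m₁ → RVec m₂ → ℝ} {g : Fin n₂ → RVec m₁ → RVec m₂ → ℝ}

theorem ConvexConcave.neg_swap {U : RVec m₁ → RVec m₂ → ℝ} (hU : ConvexConcave U) :
    ConvexConcave fun y x => -U x y :=
  ⟨fun x => (hU.2 x).neg, fun y => (hU.1 y).neg⟩

theorem SaddleExistence.exists_isSaddlePoint_sum (hn : 0 < n₁) (h : SaddleExistence X Y f) :
    ∃ xs ys, IsSaddlePoint X Y (fun x y => ∑ i, f i x y) xs ys := by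
  have hn' : (0 : ℝ) < (n₁ : ℝ)⁻¹ := by positivity
  obtain ⟨xs, ys, hxs, hys, hs⟩ := h (fun _ => (n₁ : ℝ)⁻¹) (fun _ => hn'.le) (by simp [hn.ne'])
  simp only [← Finset.mul_sum, mul_le_mul_iff_right₀ hn'] at hs
  exact ⟨xs, ys, hxs, hys, hs⟩

theorem BaseStepsize.isRobbinsMonroStepsize {γ : ℕ → ℝ} (hγ : BaseStepsize γ) :
    IsRobbinsMonroStepsize γ :=
  ⟨hγ.1, hγ.2.2.1, hγ.2.2.2.1, hγ.2.2.2.2⟩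

theorem isRobbinsMonroStepsize_one_div : IsRobbinsMonroStepsize fun k => 1 / ((k : ℝ) + 1) where
  pos _ := Nat.one_div_pos_of_nat
  antitone _ _ hab := Nat.one_div_le_one_div hab
  tendsto_sum := Real.tendsto_sum_range_one_div_nat_succ_atTop
  summable_sq := by
    simpa using (summable_nat_add_iff 1).2 (Real.summable_one_div_nat_pow.2 one_lt_two)

theorem IsTrajectory.exists_isCoupledRun {N : CommNetwork n₁ n₂} {γ : ℕ → ℝ}
    {φ₁ : ℕ → Fin n₁ → ℝ} {φ₂ : ℕ → Fin n₂ → ℝ} {x : ℕ → Fin n₁ → RVec m₁}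
    {y : ℕ → Fin n₂ → RVec m₂} {c₁ c₂ : ℝ} {T : ℕ}
    (h : IsTrajectory N X Y f g (fun k i => γ k / φ₁ (k + 1) i) (fun k i => γ k / φ₂ (k + 1) i) x y)
    (hX : Convex ℝ X) (hY : Convex ℝ Y) (hf : ∀ i, ConvexConcave (f i))
    (hg : ∀ i, ConvexConcave (g i)) (hfg : ∀ x ∈ X, ∀ y ∈ Y, ∑ i, f i x y = ∑ i, g i x y)
    (hbdd : BoundedSubgradients X Y f g) (hN : N.WeightRule)
    (hcontact₁ : ∀ i k, ∃ s, k ≤ s ∧ s < k + T ∧ N.Contact₁ s i)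
    (hcontact₂ : ∀ j k, ∃ s, k ≤ s ∧ s < k + T ∧ N.Contact₂ s j)
    (hA₁ : ∃ B, IsUniformlyMixing N.A₁ B c₁) (hA₂ : ∃ B, IsUniformlyMixing N.A₂ B c₂)
    (hφ₁ : IsAbsoluteProbabilitySequence N.A₁ c₁ φ₁)
    (hφ₂ : IsAbsoluteProbabilitySequence N.A₂ c₂ φ₂) :
    ∃ L u v, IsCoupledRun X Y f (fun j y x => -g j x y) L N.A₁ N.A₂ c₁ c₂ φ₁ φ₂ γ T u v x y := by
  obtain ⟨L, hL, hle⟩ := hbdd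
  obtain ⟨-, -, hrow₁, hrow₂⟩ := hN
  obtain ⟨u, v, hu, hv, hstepx, hstepy⟩ := h
  refine ⟨L, u, v, ?_⟩
  exact {
    left := ⟨hX, hf, hL.le, fun x hx y hy => (hle x hx y hy).1, hA₁, hφ₁, hstepx⟩
    right := {
      convex := hY
      convexConcave := fun j => (hg j).neg_swap
      bound_nonneg := hL.le
      norm_le := fun y hy x hx j q hq => by
        rw [← norm_neg]
        exact (hle x hx y hy).2 j (-q) (mem_concaveSubdiff_iff_neg.2 (by rwa [neg_neg]))
      exists_isUniformlyMixing := hA₂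
      isAbsoluteProbabilitySequence := hφ₂
      step := fun k j => by
        obtain ⟨q, hq, hproj⟩ := hstepy k j
        exact ⟨-q, mem_concaveSubdiff_iff_neg.1 hq, by rwa [smul_neg, sub_neg_eq_add]⟩ }
    zero_sum := fun x hx y hy => by rw [hfg x hx y hy, Finset.sum_neg_distrib, neg_neg]
    left_informed := fun k hk i => isRecentAverage_of_isGreatest
      (fun t ht => ⟨fun _ => N.weight_nonneg t _ _, hrow₁ t i ht⟩) (hcontact₁ i) (hu k i) hk
    right_informed := fun k hk j => isRecentAverage_of_isGreatest
      (fun t ht => ⟨fun _ => N.weight_nonneg t _ _, hrow₂ t j ht⟩) (hcontact₂ j) (hv k j) hk }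

end Game

theorem theorem4_general {n₁ n₂ m₁ m₂ : ℕ} (hn₁ : 0 < n₁) (hn₂ : 0 < n₂)
    (X : Set (RVec m₁)) (Y : Set (RVec m₂))
    (hXclosed : IsClosed X) (hXconvex : Convex ℝ X)
    (hYclosed : IsClosed Y) (hYconvex : Convex ℝ Y)
    (f : Fin n₁ → RVec m₁ → RVec m₂ → ℝ) (g : Fin n₂ → RVec m₁ → RVec m₂ → ℝ)
    (hf : ∀ i, ConvexConcave (f i)) (hg : ∀ i, ConvexConcave (g i))
    (hfg : ∀ x ∈ X, ∀ y ∈ Y, ∑ i, f i x y = ∑ i, g i x y)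
    (hsaddle : ∃ xs ys, IsSaddlePoint X Y (fun x y => ∑ i, f i x y) xs ys)
    (hbdd : BoundedSubgradients X Y f g)
    (hU : StrictConvexConcaveOn X Y (fun x y => ∑ i, f i x y))
    (N : CommNetwork n₁ n₂) (hconn : N.Connectivity) (hweight : N.WeightRule) :
    (∃ (α : ℕ → Fin n₁ → ℝ) (β : ℕ → Fin n₂ → ℝ),
      (∀ k i, 0 < α k i) ∧ (∀ k i, 0 < β k i) ∧ AchievesNash N X Y f g α β) ∧
    (∃ (φ₁ : ℕ → Fin n₁ → ℝ) (φ₂ : ℕ → Fin n₂ → ℝ),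
      (∀ s, IsLimitVector N.A₁ s (φ₁ s)) ∧ (∀ s, IsLimitVector N.A₂ s (φ₂ s)) ∧
      ∀ γ : ℕ → ℝ, IsRobbinsMonroStepsize γ →
        AchievesNash N X Y f g
          (fun k i => γ k / φ₁ (k + 1) i) (fun k i => γ k / φ₂ (k + 1) i)) := by
  have : Nonempty (Fin n₁) := Fin.pos_iff_nonempty.1 hn₁
  have : Nonempty (Fin n₂) := Fin.pos_iff_nonempty.1 hn₂
  obtain ⟨xs, ys, hs⟩ := hsaddle
  obtain ⟨T, hcontact₁, hcontact₂⟩ := hconn.exists_contact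
  obtain ⟨c₁, φ₁, hA₁, hφ₁, hlim₁⟩ := hweight.exists_isLimitVector₁ hconn.2.1
  obtain ⟨c₂, φ₂, hA₂, hφ₂, hlim₂⟩ := hweight.exists_isLimitVector₂ hconn.2.2
  have hnash : ∀ γ : ℕ → ℝ, IsRobbinsMonroStepsize γ → AchievesNash N X Y f g
      (fun k i => γ k / φ₁ (k + 1) i) (fun k i => γ k / φ₂ (k + 1) i) := fun γ hγ x y hxy => by
    obtain ⟨L, u, v, hrun⟩ := hxy.exists_isCoupledRun hXconvex hYconvex hf hg hfg hbdd hweight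
      hcontact₁ hcontact₂ hA₁ hA₂ hφ₁ hφ₂
    exact ⟨xs, ys, hs, hrun.tendsto_saddlePoint hγ hXclosed hYclosed hU hs⟩
  have hγ := isRobbinsMonroStepsize_one_div
  exact ⟨⟨_, _, fun k i => div_pos (hγ.pos k) (hφ₁.entry_pos (k + 1) i),
    fun k i => div_pos (hγ.pos k) (hφ₂.entry_pos (k + 1) i), hnash _ hγ⟩,
    φ₁, φ₂, hlim₁, hlim₂, hnash⟩

theorem theorem4 {n₁ n₂ m₁ m₂ : ℕ} (hn₁ : 0 < n₁) (hn₂ : 0 < n₂)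
    (X : Set (RVec m₁)) (Y : Set (RVec m₂))
    (hXclosed : IsClosed X) (hXconvex : Convex ℝ X)
    (hYclosed : IsClosed Y) (hYconvex : Convex ℝ Y)
    (f : Fin n₁ → RVec m₁ → RVec m₂ → ℝ) (g : Fin n₂ → RVec m₁ → RVec m₂ → ℝ)
    (hf : ∀ i, ConvexConcave (f i)) (hg : ∀ i, ConvexConcave (g i))
    (hfg : ∀ x ∈ X, ∀ y ∈ Y, ∑ i, f i x y = ∑ i, g i x y)
    (hA1 : SaddleExistence X Y f)
    (hA4 : BoundedSubgradients X Y f g)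
    (hU : StrictConvexConcaveOn X Y (fun x y => ∑ i, f i x y))
    (N : CommNetwork n₁ n₂) (hA2 : N.Connectivity) (hA3 : N.WeightRule) :
    (∃ (α : ℕ → Fin n₁ → ℝ) (β : ℕ → Fin n₂ → ℝ),
      (∀ k i, 0 < α k i) ∧ (∀ k i, 0 < β k i) ∧ AchievesNash N X Y f g α β) ∧
    (∃ (φ₁ : ℕ → Fin n₁ → ℝ) (φ₂ : ℕ → Fin n₂ → ℝ),
      (∀ s, IsLimitVector N.A₁ s (φ₁ s)) ∧ (∀ s, IsLimitVector N.A₂ s (φ₂ s)) ∧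
      ∀ γ : ℕ → ℝ, BaseStepsize γ →
        AchievesNash N X Y f g
          (fun k i => γ k / φ₁ (k + 1) i) (fun k i => γ k / φ₂ (k + 1) i)) := by
  obtain ⟨hexists, φ₁, φ₂, hlim₁, hlim₂, hnash⟩ := theorem4_general hn₁ hn₂ X Y hXclosed hXconvex
    hYclosed hYconvex f g hf hg hfg (hA1.exists_isSaddlePoint_sum hn₁) hA4 hU N hA2 hA3
  exact ⟨hexists, φ₁, φ₂, hlim₁, hlim₂, fun γ hγ => hnash γ hγ.isRobbinsMonroStepsize⟩
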